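/- All graphs are finite and simple. For a graph $G$, let $\Delta(G)$ be its maximum degree and let $\operatorname{mad}(G)=\max_H \frac{2|E(H)|}{|V(H)|}$, the maximum being over the (non-empty) subgraphs $H$ of $G$. The square $G^2$ of $G$ has the same vertices as $G$, two distinct vertices being adjacent in $G^2$ if and only if they are adjacent or have a common neighbor in $G$. Let $\chi^2(G)$ be the chromatic number of $G^2$, and let $\chi^2_\ell(G)$ be the list chromatic number of $G^2$, i.e. the least $k$ such that, for every assignment of a set of $k$ colors to each vertex, $G^2$ has a proper coloring in which every vertex receives a color from its own set. **Theorem.** (i) There is a function $f:\mathbb R\to\mathbb R$, which can be chosen with $f(\varepsilon)=3/\varepsilon^2$ for $0<\varepsilon\le 1/20$, such that for every $\varepsilon>0$, every graph $G$ with $\operatorname{mad}(G)<3-\varepsilon$ and $\Delta(G)\ge f(\varepsilon)$ satisfies $\chi^2_\ell(G)=\Delta(G)+1$. (ii) The bound $3$ is sharp: for every $N$ there is a graph $G$ with $\operatorname{mad}(G)<3$ and $\Delta(G)\ge N$ such that $\chi^2(G)>\Delta(G)+1$, and hence also $\chi^2_\ell(G)>\Delta(G)+1$. -/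

import Mathlib

noncomputable section

namespace SimpleGraph

/-- The square of `G`: distinct vertices are adjacent when they are adjacent in `G` or have a
common neighbor in `G`. -/
def square {V : Type*} (G : SimpleGraph V) : SimpleGraph V where
  Adj u v := u ≠ v ∧ (G.Adj u v ∨ ∃ w, G.Adj u w ∧ G.Adj w v)
  symm := ⟨by
    rintro u v ⟨hne, h⟩
    refine ⟨hne.symm, ?_⟩
    rcases h with h | ⟨w, h1, h2⟩
    · exact Or.inl h.symm
    · exact Or.inr ⟨w, h2.symm, h1.symm⟩⟩
  loopless := ⟨fun _ h => h.1 rfl⟩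

/-- `G` is list `k`-colorable: whenever every vertex `v` is assigned a set `L v` of exactly `k`
colors, there is a proper coloring of `G` in which every vertex gets a color from its own set. -/
def ListColorable {V : Type*} (G : SimpleGraph V) (k : ℕ) : Prop :=
  ∀ L : V → Finset ℕ, (∀ v, (L v).card = k) → ∃ C : G.Coloring ℕ, ∀ v, C v ∈ L v

/-- The list chromatic number: the least `k` such that `G` is list `k`-colorable
(`⊤` if there is none, which does not happen for a finite graph). -/
def listChromaticNumber {V : Type*} (G : SimpleGraph V) : ℕ∞ :=
  ⨅ k ∈ {k : ℕ | G.ListColorable k}, (k : ℕ∞)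

/-- The average degree `2|E(H)| / |V(H)|` of a subgraph `H`
(equal to `0` for the subgraph without vertices). -/
def Subgraph.averageDegree {V : Type*} {G : SimpleGraph V} (H : G.Subgraph) : ℝ :=
  2 * (H.edgeSet.ncard : ℝ) / (H.verts.ncard : ℝ)

/-- The maximum average degree of a finite graph: the maximum of the average degrees of its
subgraphs. There are finitely many subgraphs, so the supremum is a maximum; the subgraph without
vertices contributes `0`, which is also the average degree of any single vertex. -/
def maxAverageDegree {V : Type*} (G : SimpleGraph V) : ℝ :=
  ⨆ H : G.Subgraph, H.averageDegree

end SimpleGraph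

end

open Finset

/-- A kernel (stable matching) for a set `F` of edges of a bipartite multigraph, with the edges at
each vertex ranked by `p` on one side and by `q` on the other. -/
theorem exists_stable_matching {E Y T : Type*} [DecidableEq E] (y : E → Y) (t : E → T)
    (p q : E → ℕ) (F : Finset E)
    (hp : ∀ a ∈ F, ∀ b ∈ F, y a = y b → p a = p b → a = b)
    (hq : ∀ a ∈ F, ∀ b ∈ F, t a = t b → q a = q b → a = b) :
    ∃ K ⊆ F, (∀ a ∈ K, ∀ b ∈ K, a ≠ b → y a ≠ y b ∧ t a ≠ t b) ∧
      ∀ e ∈ F, e ∉ K → ∃ a ∈ K, (y a = y e ∧ p a < p e) ∨ (t a = t e ∧ q a < q e) := by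
  classical
  induction F using Finset.strongInduction with
  | H F ih =>
  by_cases h : ∃ e ∈ F, ∃ e' ∈ F, (∀ a ∈ F, y a = y e' → p e' ≤ p a) ∧ t e' = t e ∧ q e' < q e
  · obtain ⟨e, he, e', he', htop, hte, hqe⟩ := h
    have hne : e' ≠ e := by rintro rfl; omega
    obtain ⟨K, hKF, hK, hdom⟩ := ih (F.erase e) (erase_ssubset he)
      (fun a ha b hb => hp a (mem_of_mem_erase ha) b (mem_of_mem_erase hb))
      (fun a ha b hb => hq a (mem_of_mem_erase ha) b (mem_of_mem_erase hb))
    refine ⟨K, hKF.trans (erase_subset _ _), hK, fun a ha haK => ?_⟩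
    by_cases hae : a = e
    · subst hae
      by_cases hK' : e' ∈ K
      · exact ⟨e', hK', Or.inr ⟨hte, hqe⟩⟩
      · obtain ⟨b, hb, h⟩ := hdom e' (mem_erase.2 ⟨hne, he'⟩) hK'
        rcases h with ⟨h1, h2⟩ | ⟨h1, h2⟩
        · have := htop b (mem_of_mem_erase (hKF hb)) h1
          omega
        · exact ⟨b, hb, Or.inr ⟨h1.trans hte, h2.trans hqe⟩⟩
    · exact hdom a (mem_erase.2 ⟨hae, ha⟩) haK
  · push Not at h
    refine ⟨F.filter fun e => ∀ a ∈ F, y a = y e → p e ≤ p a, filter_subset _ _, ?_, ?_⟩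
    · intro a ha b hb hab
      simp only [mem_filter] at ha hb
      refine ⟨fun hy => hab (hp a ha.1 b hb.1 hy
        (le_antisymm (ha.2 b hb.1 hy.symm) (hb.2 a ha.1 hy))), fun ht => hab ?_⟩
      exact hq a ha.1 b hb.1 ht (le_antisymm (h b hb.1 a ha.1 ha.2 ht |> fun h1 =>
        h a ha.1 b hb.1 hb.2 ht.symm) (h b hb.1 a ha.1 ha.2 ht))
    · intro e he heK
      obtain ⟨a, ha, hmin⟩ := exists_min_image (F.filter fun a => y a = y e) p
        ⟨e, by simp [he]⟩
      simp only [mem_filter] at ha hmin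
      refine ⟨a, mem_filter.2 ⟨ha.1, fun b hb hy => hmin b ⟨hb, hy.trans ha.2⟩⟩,
        Or.inl ⟨ha.2, lt_of_le_of_ne (hmin e ⟨he, rfl⟩) fun hpe => heK ?_⟩⟩
      have hae := hp a ha.1 e he ha.2 hpe
      subst hae
      exact mem_filter.2 ⟨he, fun b hb hy => hmin b ⟨hb, hy⟩⟩

/-- Galvin's argument: list edge coloring of a bipartite multigraph from ranks. -/
theorem exists_list_edge_coloring_of_rank {E Y T : Type*} [DecidableEq E] [DecidableEq Y]
    [DecidableEq T] (y : E → Y) (t : E → T) (p q : E → ℕ) (F : Finset E) (L : E → Finset ℕ)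
    (hp : ∀ a ∈ F, ∀ b ∈ F, y a = y b → p a = p b → a = b)
    (hq : ∀ a ∈ F, ∀ b ∈ F, t a = t b → q a = q b → a = b)
    (hL : ∀ e ∈ F, #{a ∈ F | y a = y e ∧ p a < p e} + #{a ∈ F | t a = t e ∧ q a < q e} < #(L e)) :
    ∃ C : E → ℕ, (∀ e ∈ F, C e ∈ L e) ∧
      ∀ a ∈ F, ∀ b ∈ F, a ≠ b → (y a = y b ∨ t a = t b) → C a ≠ C b := by
  induction F using Finset.strongInduction generalizing L with
  | H F ih =>
  rcases F.eq_empty_or_nonempty with rfl | ⟨e₀, he₀⟩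
  · exact ⟨fun _ => 0, by simp, by simp⟩
  obtain ⟨α, hα⟩ := card_pos.1 (lt_of_le_of_lt (Nat.zero_le _) (hL e₀ he₀))
  have hsub := filter_subset (fun e => α ∈ L e) F
  obtain ⟨K, hKF, hK, hdom⟩ := exists_stable_matching y t p q (F.filter fun e => α ∈ L e)
    (fun a ha b hb => hp a (hsub ha) b (hsub hb)) (fun a ha b hb => hq a (hsub ha) b (hsub hb))
  have hKne : K.Nonempty := by
    by_contra hne
    rw [not_nonempty_iff_eq_empty] at hne
    subst hne
    obtain ⟨a, ha, -⟩ := hdom e₀ (mem_filter.2 ⟨he₀, hα⟩) (by simp)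
    simp at ha
  have hKF' : K ⊆ F := hKF.trans hsub
  have hsd : F \ K ⊆ F := sdiff_subset
  obtain ⟨C, hC, hCne⟩ := ih (F \ K) (sdiff_ssubset hKF' hKne) (fun e => (L e).erase α)
    (fun a ha b hb => hp a (hsd ha) b (hsd hb)) (fun a ha b hb => hq a (hsd ha) b (hsd hb)) (by
      intro e he
      obtain ⟨heF, heK⟩ := mem_sdiff.1 he
      have h1 : {a ∈ F \ K | y a = y e ∧ p a < p e} ⊆ {a ∈ F | y a = y e ∧ p a < p e} :=
        filter_subset_filter _ hsd
      have h2 : {a ∈ F \ K | t a = t e ∧ q a < q e} ⊆ {a ∈ F | t a = t e ∧ q a < q e} :=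
        filter_subset_filter _ hsd
      have h1' := card_le_card h1
      have h2' := card_le_card h2
      have h3 := hL e heF
      by_cases hαe : α ∈ L e
      · rw [card_erase_of_mem hαe]
        obtain ⟨a, ha, h | h⟩ := hdom e (mem_filter.2 ⟨heF, hαe⟩) heK
        · have := card_lt_card (h1.ssubset_of_mem_notMem
            (mem_filter.2 ⟨hKF' ha, h⟩) (by simp [ha]))
          omega
        · have := card_lt_card (h2.ssubset_of_mem_notMem
            (mem_filter.2 ⟨hKF' ha, h⟩) (by simp [ha]))
          omega
      · rw [erase_eq_of_notMem hαe]
        omega)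
  refine ⟨fun e => if e ∈ K then α else C e, fun e he => ?_, fun a ha b hb hab hyt => ?_⟩
  · by_cases heK : e ∈ K
    · simpa [heK] using (mem_filter.1 (hKF heK)).2
    · simpa [heK] using mem_of_mem_erase (hC e (mem_sdiff.2 ⟨he, heK⟩))
  · by_cases haK : a ∈ K <;> by_cases hbK : b ∈ K
    · have := hK a haK b hbK hab
      tauto
    · simpa [haK, hbK] using (ne_of_mem_erase (hC b (mem_sdiff.2 ⟨hb, hbK⟩))).symm
    · simpa [haK, hbK] using ne_of_mem_erase (hC a (mem_sdiff.2 ⟨ha, haK⟩))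
    · simpa [haK, hbK] using hCne a (mem_sdiff.2 ⟨ha, haK⟩) b (mem_sdiff.2 ⟨hb, hbK⟩) hab hyt

/-- Every vertex on one side picks an incident edge so that a vertex `s` of the other side is
picked at most `b s + 1` times. -/
theorem exists_edge_choice {E Y T : Type*} [DecidableEq E] [DecidableEq Y] [DecidableEq T]
    (y : E → Y) (t : E → T) (b : T → ℕ) (F : Finset E)
    (h : ∀ e ∈ F, #{a ∈ F | t a = t e} ≤ #{a ∈ F | y a = y e} + b (t e)) :
    ∃ M ⊆ F, (∀ e ∈ F, ∃ a ∈ M, y a = y e) ∧ (∀ a ∈ M, ∀ c ∈ M, y a = y c → a = c) ∧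
      ∀ s, #{a ∈ M | t a = s} ≤ b s + 1 := by
  classical
  let N : {x // x ∈ F.image y} → Finset (T × ℕ) := fun x =>
    {a ∈ F | y a = x}.biUnion fun a => (range (b (t a) + 1)).image fun i => (t a, i)
  have hall : ∀ A : Finset {x // x ∈ F.image y}, #A ≤ #(A.biUnion N) := by
    intro A
    set FA := {a ∈ F | ∃ x ∈ A, y a = x} with hFA
    have hcardN : (A.biUnion N) = ((FA.image t).sigma fun s => range (b s + 1)).image
        fun z : (_ : T) × ℕ => (z.1, z.2) := by
      ext ⟨s, i⟩
      simp only [N, hFA, mem_biUnion, mem_filter, mem_image, mem_sigma, mem_range, Prod.mk.injEq]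
      constructor
      · rintro ⟨x, hx, a, ⟨ha, hax⟩, j, hj, rfl, rfl⟩
        exact ⟨⟨t a, j⟩, ⟨⟨a, ⟨ha, x, hx, hax⟩, rfl⟩, hj⟩, rfl, rfl⟩
      · rintro ⟨⟨s', j⟩, ⟨⟨a, ⟨ha, x, hx, hax⟩, hs⟩, hj⟩, h1, h2⟩
        simp only at h1 h2 hs hj
        subst h1 h2 hs
        exact ⟨x, hx, a, ⟨ha, hax⟩, j, hj, rfl, rfl⟩
    rw [hcardN, card_image_of_injective _ (by rintro ⟨a, b⟩ ⟨c, d⟩ h; simp at h; simp [h]),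
      card_sigma]
    simp only [card_range]
    let wt : E → ℚ := fun e => 1 / (#{a ∈ F | y a = y e} : ℚ)
    have hA : (#A : ℚ) = ∑ e ∈ FA, wt e := by
      have hFA' : FA = A.biUnion fun x => {a ∈ F | y a = x} := by
        ext a; simp only [hFA, mem_filter, mem_biUnion]; tauto
      rw [hFA', sum_biUnion]
      · rw [card_eq_sum_ones, Nat.cast_sum]
        refine sum_congr rfl fun x hx => ?_
        have : ∀ e ∈ F.filter (fun a => y a = x), wt e = 1 / (#{a ∈ F | y a = x} : ℚ) := by
          intro e he
          simp only [wt, (mem_filter.1 he).2]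
        rw [sum_congr rfl this, sum_const, nsmul_eq_mul]
        have hpos : #{a ∈ F | y a = x} ≠ 0 := by
          obtain ⟨a, ha, hax⟩ := mem_image.1 x.2
          exact (card_pos.2 ⟨a, mem_filter.2 ⟨ha, hax⟩⟩).ne'
        field_simp
        simp
      · intro x _ x' _ hne
        refine disjoint_left.2 fun a ha ha' => hne (Subtype.ext ?_)
        rw [← (mem_filter.1 ha).2, (mem_filter.1 ha').2]
    have hB : ∑ e ∈ FA, wt e ≤ ∑ s ∈ FA.image t, ((b s : ℚ) + 1) := by
      rw [← sum_fiberwise_of_maps_to (g := t) (t := FA.image t)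
        (fun e he => mem_image_of_mem _ he)]
      refine sum_le_sum fun s hs => ?_
      obtain ⟨e₀, he₀, rfl⟩ := mem_image.1 hs
      have hsub : {e ∈ FA | t e = t e₀} ⊆ {e ∈ F | t e = t e₀} :=
        filter_subset_filter _ (filter_subset _ _)
      set n := #{e ∈ F | t e = t e₀} with hn
      have hcard : (#{e ∈ FA | t e = t e₀} : ℚ) ≤ n := by exact_mod_cast card_le_card hsub
      have hd : ∀ e ∈ {e ∈ FA | t e = t e₀}, (1 : ℚ) ≤ #{a ∈ F | y a = y e} ∧
          (n : ℚ) ≤ #{a ∈ F | y a = y e} + b (t e₀) := by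
        intro e he
        obtain ⟨heF, het⟩ := mem_filter.1 (hsub he)
        have h1 := h e heF
        rw [het] at h1
        have h2 : 1 ≤ #{a ∈ F | y a = y e} := card_pos.2 ⟨e, mem_filter.2 ⟨heF, rfl⟩⟩
        exact ⟨by exact_mod_cast h2, by exact_mod_cast h1⟩
      have hb0 : (0 : ℚ) ≤ b (t e₀) := by positivity
      rcases le_or_gt n (b (t e₀) + 1) with hle | hgt
      · refine (sum_le_card_nsmul _ _ 1 fun e he => ?_).trans ?_
        · exact (div_le_one (by linarith [(hd e he).1])).2 (hd e he).1
        · rw [nsmul_eq_mul, mul_one]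
          exact hcard.trans (by exact_mod_cast hle)
      · have hgt' : (b (t e₀) : ℚ) + 1 < n := by exact_mod_cast hgt
        have hpos : (0 : ℚ) < n - b (t e₀) := by linarith
        refine (sum_le_card_nsmul _ _ (1 / ((n : ℚ) - b (t e₀))) fun e he => ?_).trans ?_
        · exact one_div_le_one_div_of_le hpos (by linarith [(hd e he).2])
        · rw [nsmul_eq_mul, mul_one_div, div_le_iff₀ hpos]
          nlinarith
    have : (#A : ℚ) ≤ ((∑ s ∈ FA.image t, (b s + 1) : ℕ) : ℚ) := by
      push_cast
      rw [hA]; exact hB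
    exact_mod_cast this
  obtain ⟨g, hg, hgN⟩ := (Finset.all_card_le_biUnion_card_iff_exists_injective N).1 hall
  have hpick : ∀ x : {x // x ∈ F.image y}, ∃ a ∈ F, y a = x ∧ (g x).1 = t a ∧
      (g x).2 < b (t a) + 1 := by
    intro x
    have := hgN x
    simp only [N, mem_biUnion, mem_filter, mem_image, mem_range] at this
    obtain ⟨a, ⟨ha, hax⟩, i, hi, hgi⟩ := this
    exact ⟨a, ha, hax, by rw [← hgi], by rw [← hgi]; exact hi⟩
  choose a haF hay hat hab using hpick
  refine ⟨univ.image a, ?_, ?_, ?_, ?_⟩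
  · intro e he
    obtain ⟨x, -, rfl⟩ := mem_image.1 he
    exact haF x
  · intro e he
    exact ⟨a ⟨y e, mem_image_of_mem _ he⟩, mem_image_of_mem _ (mem_univ _), hay _⟩
  · intro e he e' he' hee
    obtain ⟨x, -, rfl⟩ := mem_image.1 he
    obtain ⟨x', -, rfl⟩ := mem_image.1 he'
    rw [hay, hay] at hee
    rw [Subtype.ext hee]
  · intro s
    rw [← card_range (b s + 1), filter_image]
    refine card_image_le.trans (card_le_card_of_injOn (fun x => (g x).2) ?_ ?_)
    · intro x hx
      have h1 := hab x
      rw [(mem_filter.1 hx).2] at h1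
      exact mem_coe.2 (mem_range.2 h1)
    · intro x hx x' hx' hee
      refine hg (Prod.ext ?_ hee)
      rw [hat, hat, (mem_filter.1 hx).2, (mem_filter.1 hx').2]

/-- If each edge satisfies `deg t ≤ deg y + b t`, the edges at each vertex can be ranked so that
the ranks of an edge at its two ends add up to less than `deg y + b t`. -/
theorem exists_edge_ranks {E Y T : Type*} [DecidableEq E] [DecidableEq Y] [DecidableEq T]
    (y : E → Y) (t : E → T) (b : T → ℕ) (F : Finset E)
    (h : ∀ e ∈ F, #{a ∈ F | t a = t e} ≤ #{a ∈ F | y a = y e} + b (t e)) :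
    ∃ p q : E → ℕ, (∀ a ∈ F, ∀ c ∈ F, y a = y c → p a = p c → a = c) ∧
      (∀ a ∈ F, ∀ c ∈ F, t a = t c → q a = q c → a = c) ∧
      ∀ e ∈ F, p e < #{a ∈ F | y a = y e} ∧ p e + q e < #{a ∈ F | y a = y e} + b (t e) := by
  classical
  induction F using Finset.strongInduction generalizing b with
  | H F ih =>
  rcases F.eq_empty_or_nonempty with rfl | ⟨e₀, he₀⟩
  · exact ⟨fun _ => 0, fun _ => 0, by simp, by simp, by simp⟩
  obtain ⟨M, hMF, hMy, hMinj, hMt⟩ := exists_edge_choice y t b F h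
  have hMne : M.Nonempty := let ⟨a, ha, _⟩ := hMy e₀ he₀; ⟨a, ha⟩
  have hsd : F \ M ⊆ F := sdiff_subset
  have hdy : ∀ e ∈ F, #{a ∈ F | y a = y e} = #{a ∈ F \ M | y a = y e} + 1 := by
    intro e he
    obtain ⟨a, ha, hae⟩ := hMy e he
    have h1 : {c ∈ F | y c = y e} = insert a {c ∈ F \ M | y c = y e} := by
      ext c
      simp only [mem_filter, mem_insert, mem_sdiff]
      constructor
      · rintro ⟨hc, hce⟩
        by_cases hcM : c ∈ M
        · exact Or.inl (hMinj c hcM a ha (hce.trans hae.symm))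
        · exact Or.inr ⟨⟨hc, hcM⟩, hce⟩
      · rintro (rfl | ⟨⟨hc, -⟩, hce⟩)
        · exact ⟨hMF ha, hae⟩
        · exact ⟨hc, hce⟩
    rw [h1, card_insert_of_notMem (by simp [ha])]
  have hdt : ∀ s, #{a ∈ F | t a = s} = #{a ∈ F \ M | t a = s} + #{a ∈ M | t a = s} := by
    intro s
    rw [← card_union_of_disjoint, ← filter_union, sdiff_union_of_subset hMF]
    exact disjoint_filter_filter sdiff_disjoint
  obtain ⟨p, q, hp, hq, hpq⟩ := ih (F \ M) (sdiff_ssubset hMF hMne)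
    (fun s => b s + 1 - #{a ∈ M | t a = s}) (by
      intro e he
      have h1 := h e (hsd he)
      have h2 := hdy e (hsd he)
      have h3 := hdt (t e)
      have h4 := hMt (t e)
      omega)
  obtain ⟨r, hr, hrlt⟩ : ∃ r : E → ℕ, (∀ a ∈ M, ∀ c ∈ M, t a = t c → r a = r c → a = c) ∧
      ∀ a ∈ M, r a < #{c ∈ M | t c = t a} := by
    have hex : ∀ s, ∃ r : E → ℕ, ∀ a ∈ M, t a = s → r a < #{c ∈ M | t c = s} ∧
        ∀ c ∈ M, t c = s → r a = r c → a = c := by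
      intro s
      let e := ({c ∈ M | t c = s}).equivFin
      refine ⟨fun a => if ha : a ∈ M.filter fun c => t c = s then e ⟨a, ha⟩ else 0,
        fun a ha hs => ?_⟩
      have ha' : a ∈ M.filter fun c => t c = s := mem_filter.2 ⟨ha, hs⟩
      simp only [dif_pos ha']
      refine ⟨(e ⟨a, ha'⟩).2, fun c hc hcs hac => ?_⟩
      have hc' : c ∈ M.filter fun c => t c = s := mem_filter.2 ⟨hc, hcs⟩
      rw [dif_pos hc'] at hac
      simpa using e.injective (Fin.ext hac)
    choose r hr using hex
    exact ⟨fun a => r (t a) a, fun a ha c hc hac hrac => (hr (t a) a ha rfl).2 c hc hac.symm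
      (hrac.trans (by rw [hac])), fun a ha => (hr (t a) a ha rfl).1⟩
  refine ⟨fun e => if e ∈ M then #{a ∈ F | y a = y e} - 1 else p e,
    fun e => if e ∈ M then r e else q e + #{a ∈ M | t a = t e}, ?_, ?_, ?_⟩
  · intro a ha c hc hy hac
    by_cases haM : a ∈ M <;> by_cases hcM : c ∈ M <;> simp only [haM, hcM, if_true, if_false] at hac
    · exact hMinj a haM c hcM hy
    · have h1 := (hpq c (mem_sdiff.2 ⟨hc, hcM⟩)).1
      have h2 := hdy c hc
      rw [hy] at hac
      omega
    · have h1 := (hpq a (mem_sdiff.2 ⟨ha, haM⟩)).1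
      have h2 := hdy a ha
      rw [← hy] at hac
      omega
    · exact hp a (mem_sdiff.2 ⟨ha, haM⟩) c (mem_sdiff.2 ⟨hc, hcM⟩) hy hac
  · intro a ha c hc ht hac
    by_cases haM : a ∈ M <;> by_cases hcM : c ∈ M <;> simp only [haM, hcM, if_true, if_false] at hac
    · exact hr a haM c hcM ht hac
    · have h1 := hrlt a haM
      rw [ht] at h1
      omega
    · have h1 := hrlt c hcM
      rw [← ht] at h1
      omega
    · rw [ht] at hac
      exact hq a (mem_sdiff.2 ⟨ha, haM⟩) c (mem_sdiff.2 ⟨hc, hcM⟩) ht (by omega)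
  · intro e he
    have h2 := hdy e he
    have h4 := hMt (t e)
    by_cases heM : e ∈ M <;> simp only [heM, if_true, if_false]
    · have h1 := hrlt e heM
      omega
    · have h1 := hpq e (mem_sdiff.2 ⟨he, heM⟩)
      omega

/-- The list edge coloring theorem of Borodin, Kostochka and Woodall for bipartite multigraphs in
which every edge has at its end in `Y` a degree at least as large as at its end in `T`. -/
theorem exists_list_edge_coloring {E Y T : Type*} [DecidableEq E] [DecidableEq Y] [DecidableEq T]
    (y : E → Y) (t : E → T) (F : Finset E) (L : E → Finset ℕ)
    (h : ∀ e ∈ F, #{a ∈ F | t a = t e} ≤ #{a ∈ F | y a = y e})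
    (hL : ∀ e ∈ F, #{a ∈ F | y a = y e} ≤ #(L e)) :
    ∃ C : E → ℕ, (∀ e ∈ F, C e ∈ L e) ∧
      ∀ a ∈ F, ∀ b ∈ F, a ≠ b → (y a = y b ∨ t a = t b) → C a ≠ C b := by
  obtain ⟨p, q, hp, hq, hpq⟩ := exists_edge_ranks y t (fun _ => 0) F h
  refine exists_list_edge_coloring_of_rank y t p q F L hp hq fun e he => ?_
  have h1 : #{a ∈ F | y a = y e ∧ p a < p e} ≤ p e := by
    conv_rhs => rw [← card_range (p e)]
    refine card_le_card_of_injOn p (fun a ha => ?_) fun a ha c hc hac => ?_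
    · exact mem_coe.2 (mem_range.2 (mem_filter.1 ha).2.2)
    · obtain ⟨ha1, ha2, -⟩ := mem_filter.1 ha
      obtain ⟨hc1, hc2, -⟩ := mem_filter.1 hc
      exact hp a ha1 c hc1 (ha2.trans hc2.symm) hac
  have h2 : #{a ∈ F | t a = t e ∧ q a < q e} ≤ q e := by
    conv_rhs => rw [← card_range (q e)]
    refine card_le_card_of_injOn q (fun a ha => ?_) fun a ha c hc hac => ?_
    · exact mem_coe.2 (mem_range.2 (mem_filter.1 ha).2.2)
    · obtain ⟨ha1, ha2, -⟩ := mem_filter.1 ha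
      obtain ⟨hc1, hc2, -⟩ := mem_filter.1 hc
      exact hq a ha1 c hc1 (ha2.trans hc2.symm) hac
  have h3 := (hpq e he).2
  have h4 := hL e he
  omega

namespace SimpleGraph

open scoped Classical

variable {V : Type*}

/-- `C` colors the vertices in `A` from the lists `L`, properly for the square of `G`. -/
def IsPartialListColoring (G : SimpleGraph V) (L : V → Finset ℕ) (A : Set V) (C : V → ℕ) : Prop :=
  (∀ v ∈ A, C v ∈ L v) ∧ ∀ u ∈ A, ∀ v ∈ A, G.square.Adj u v → C u ≠ C v

/-- The square of `G` has no coloring from the lists `L`, but the square of every graph with fewer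
edges has one. -/
structure IsSquareCritical (G : SimpleGraph V) (L : V → Finset ℕ) : Prop where
  not_colorable : ∀ C, ¬ G.IsPartialListColoring L Set.univ C
  colorable_of_lt : ∀ G' < G, ∃ C, G'.IsPartialListColoring L Set.univ C

theorem IsSquareCritical.exists_partial {G : SimpleGraph V} {L : V → Finset ℕ}
    (hG : G.IsSquareCritical L) {W R : Set V} (hWR : W ⊆ R) (hW : ∃ w ∈ W, ∃ u, G.Adj w u)
    (hnb : ∀ w ∈ W, ∀ a ∉ R, ∀ b ∉ R, G.Adj w a → G.Adj w b → a = b) :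
    ∃ C, G.IsPartialListColoring L Rᶜ C := by
  let G' : SimpleGraph V :=
    { Adj := fun a b => G.Adj a b ∧ a ∉ W ∧ b ∉ W
      symm := ⟨fun a b h => ⟨h.1.symm, h.2.2, h.2.1⟩⟩
      loopless := ⟨fun a h => h.1.ne rfl⟩ }
  have hlt : G' < G := by
    refine lt_of_le_of_ne (fun a b h => h.1) fun h => ?_
    obtain ⟨w, hw, u, hwu⟩ := hW
    rw [← h] at hwu
    exact hwu.2.1 hw
  obtain ⟨C, hC, hC'⟩ := hG.colorable_of_lt G' hlt
  refine ⟨C, fun v _ => hC v trivial, fun a ha b hb hab => hC' a trivial b trivial ⟨hab.1, ?_⟩⟩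
  have haW : a ∉ W := fun h => ha (hWR h)
  have hbW : b ∉ W := fun h => hb (hWR h)
  rcases hab.2 with h | ⟨w, h1, h2⟩
  · exact Or.inl ⟨h, haW, hbW⟩
  · have hwW : w ∉ W := fun hw => hab.1 (hnb w hw a ha b hb h1.symm h2)
    exact Or.inr ⟨w, ⟨h1, haW, hwW⟩, ⟨h2, hwW, hbW⟩⟩

variable [Fintype V] {G : SimpleGraph V} {L : V → Finset ℕ}

theorem card_square_adj_le (G : SimpleGraph V) (v : V) :
    #{u | G.square.Adj v u} ≤ ∑ z ∈ G.neighborFinset v, G.degree z := by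
  have hsub : ({u | G.square.Adj v u} : Finset V) ⊆
      (G.neighborFinset v).biUnion fun z => insert z ((G.neighborFinset z).erase v) := by
    intro u hu
    obtain ⟨hne, h⟩ := (mem_filter.1 hu).2
    simp only [mem_biUnion, mem_insert, mem_erase, mem_neighborFinset]
    rcases h with h | ⟨z, h1, h2⟩
    · exact ⟨u, h, Or.inl rfl⟩
    · exact ⟨z, h1, Or.inr ⟨hne.symm, h2⟩⟩
  refine (card_le_card hsub).trans (card_biUnion_le.trans (sum_le_sum fun z hz => ?_))
  have hv : v ∈ G.neighborFinset z := by
    rw [mem_neighborFinset] at hz ⊢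
    exact hz.symm
  refine (card_insert_le _ _).trans ?_
  rw [card_erase_of_mem hv, card_neighborFinset_eq_degree]
  have : 0 < G.degree z := by
    rw [← card_neighborFinset_eq_degree]
    exact card_pos.2 ⟨v, hv⟩
  omega

theorem IsPartialListColoring.insert {A : Set V} {C : V → ℕ}
    (hC : G.IsPartialListColoring L A C) (v : V)
    (hv : ∑ z ∈ G.neighborFinset v, G.degree z < #(L v)) :
    ∃ C', G.IsPartialListColoring L (Insert.insert v A) C' := by
  have hlt : #(({u | G.square.Adj v u} : Finset V).image C) < #(L v) :=
    card_image_le.trans_lt ((card_square_adj_le G v).trans_lt hv)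
  obtain ⟨c, hc, hcn⟩ := exists_mem_notMem_of_card_lt_card hlt
  have hcn' : ∀ u, G.square.Adj v u → C u ≠ c := fun u hu h =>
    hcn (mem_image.2 ⟨u, by simpa using hu, h⟩)
  refine ⟨Function.update C v c, fun u hu => ?_, fun a ha b hb hab => ?_⟩
  · by_cases huv : u = v
    · subst huv; simpa using hc
    · simpa [huv] using hC.1 u (hu.resolve_left huv)
  · by_cases hav : a = v
    · subst hav
      have hba : b ≠ a := hab.ne'
      simpa [hba] using (hcn' b hab).symm
    · by_cases hbv : b = v
      · subst hbv
        simpa [hav] using hcn' a hab.symm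
      · simpa [hav, hbv] using hC.2 a (ha.resolve_left hav) b (hb.resolve_left hbv) hab

theorem IsPartialListColoring.union {A : Set V} {C : V → ℕ}
    (hC : G.IsPartialListColoring L A C) (R : Finset V)
    (hR : ∀ v ∈ R, ∑ z ∈ G.neighborFinset v, G.degree z < #(L v)) :
    ∃ C', G.IsPartialListColoring L (A ∪ R) C' := by
  induction R using Finset.induction_on with
  | empty => exact ⟨C, by simpa using hC⟩
  | insert v R _ ih =>
    obtain ⟨C₁, hC₁⟩ := ih fun u hu => hR u (mem_insert_of_mem hu)
    obtain ⟨C₂, hC₂⟩ := hC₁.insert v (hR v (mem_insert_self _ _))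
    refine ⟨C₂, ?_⟩
    rwa [coe_insert, Set.union_insert]

/-- In a critical graph, one cannot uncolor only vertices with few neighbors in the square. -/
theorem IsSquareCritical.false_of_forall_lt (hG : G.IsSquareCritical L) {W : Set V} (R : Finset V)
    (hWR : W ⊆ R) (hW : ∃ w ∈ W, ∃ u, G.Adj w u)
    (hnb : ∀ w ∈ W, ∀ a ∉ R, ∀ b ∉ R, G.Adj w a → G.Adj w b → a = b)
    (hR : ∀ v ∈ R, ∑ z ∈ G.neighborFinset v, G.degree z < #(L v)) : False := by
  obtain ⟨C, hC⟩ := hG.exists_partial hWR hW hnb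
  obtain ⟨C', hC'⟩ := hC.union R hR
  rw [Set.compl_union_self] at hC'
  exact hG.not_colorable C' hC'

theorem IsSquareCritical.degree_ne_one (hG : G.IsSquareCritical L)
    (hL : ∀ v, G.maxDegree < #(L v)) (v : V) : G.degree v ≠ 1 := by
  intro hv
  obtain ⟨u, hu⟩ := card_eq_one.1 ((card_neighborFinset_eq_degree G v).trans hv)
  have hu' : ∀ z, G.Adj v z ↔ z = u := fun z => by rw [← mem_neighborFinset, hu, mem_singleton]
  refine hG.false_of_forall_lt (W := {v}) {v} (by simp) ⟨v, rfl, u, (hu' u).2 rfl⟩ ?_ ?_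
  · rintro w rfl a - b - ha hb
    rw [(hu' a).1 ha, (hu' b).1 hb]
  · intro w hw
    rw [mem_singleton] at hw
    subst hw
    rw [hu, sum_singleton]
    exact (G.degree_le_maxDegree u).trans_lt (hL w)

theorem IsSquareCritical.le_sum_degree_of_adj (hG : G.IsSquareCritical L) {u v : V}
    (hv : G.degree v = 2) (huv : G.Adj v u)
    (hvL : ∑ z ∈ G.neighborFinset v, G.degree z < #(L v)) :
    #(L u) ≤ ∑ z ∈ G.neighborFinset u, G.degree z := by
  by_contra! h
  refine hG.false_of_forall_lt (W := {v}) {v, u} (by simp) ⟨v, rfl, u, huv⟩ ?_ ?_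
  · rintro w rfl a ha b hb hwa hwb
    by_contra hab
    simp only [mem_insert, mem_singleton, not_or] at ha hb
    have hsub : ({u, a, b} : Finset V) ⊆ G.neighborFinset w := by
      intro z hz
      simp only [mem_insert, mem_singleton] at hz
      rw [mem_neighborFinset]
      rcases hz with rfl | rfl | rfl <;> assumption
    have := card_le_card hsub
    rw [card_neighborFinset_eq_degree, hv, card_eq_three.2
      ⟨u, a, b, fun h => ha.2 h.symm, fun h => hb.2 h.symm, hab, rfl⟩] at this
    omega
  · intro w hw
    simp only [mem_insert, mem_singleton] at hw
    rcases hw with rfl | rfl <;> assumption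

end SimpleGraph

namespace SimpleGraph

open scoped Classical

variable {V : Type*} [Fintype V]

/-- A vertex of degree at least `3 / ε`. -/
def IsLarge (G : SimpleGraph V) (ε : ℝ) (v : V) : Prop := 3 / ε ≤ (G.degree v : ℝ)

/-- A vertex of degree `2` without large neighbors. -/
def IsWeak (G : SimpleGraph V) (ε : ℝ) (v : V) : Prop :=
  G.degree v = 2 ∧ ∀ u, G.Adj v u → ¬ G.IsLarge ε u

/-- The number of large neighbors. -/
noncomputable def numLarge (G : SimpleGraph V) (ε : ℝ) (v : V) : ℕ := #{u ∈ G.neighborFinset v | G.IsLarge ε u}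

/-- The number of weak neighbors. -/
noncomputable def numWeak (G : SimpleGraph V) (ε : ℝ) (v : V) : ℕ := #{u ∈ G.neighborFinset v | G.IsWeak ε u}

/-- A small vertex of small degree with one large neighbor, all other neighbors being weak. -/
def IsBranch (G : SimpleGraph V) (ε : ℝ) (v : V) : Prop :=
  ¬ G.IsLarge ε v ∧ ¬ G.IsWeak ε v ∧ G.numLarge ε v = 1 ∧ G.numWeak ε v + 1 = G.degree v ∧
    ((G.degree v : ℝ) - 1) * ε < 1

/-- A weak vertex both of whose neighbors are branch vertices. -/
def IsInner (G : SimpleGraph V) (ε : ℝ) (v : V) : Prop :=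
  G.IsWeak ε v ∧ ∀ u, G.Adj v u → G.IsBranch ε u

/-- Branch vertices are joined when they have a common weak neighbor. -/
def branchGraph (G : SimpleGraph V) (ε : ℝ) : SimpleGraph V where
  Adj u w := u ≠ w ∧ G.IsBranch ε u ∧ G.IsBranch ε w ∧ ∃ v, G.IsWeak ε v ∧ G.Adj v u ∧ G.Adj v w
  symm := ⟨fun _ _ ⟨h1, h2, h3, v, h4, h5, h6⟩ => ⟨h1.symm, h3, h2, v, h4, h6, h5⟩⟩
  loopless := ⟨fun _ h => h.1 rfl⟩

/-- The branch vertices in a component of the branch graph. -/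
noncomputable def branchSet (G : SimpleGraph V) (ε : ℝ) (c : (G.branchGraph ε).ConnectedComponent) : Finset V :=
  {w | G.IsBranch ε w ∧ (G.branchGraph ε).connectedComponentMk w = c}

/-- The inner vertices adjacent to a component of the branch graph. -/
noncomputable def innerSet (G : SimpleGraph V) (ε : ℝ) (c : (G.branchGraph ε).ConnectedComponent) : Finset V :=
  {v | G.IsInner ε v ∧ ∃ u, G.Adj v u ∧ (G.branchGraph ε).connectedComponentMk u = c}

/-- A component of the branch graph whose vertices do not have enough charge. -/
def IsPoor (G : SimpleGraph V) (ε : ℝ) (c : (G.branchGraph ε).ConnectedComponent) : Prop :=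
  (#(G.innerSet ε c) : ℝ) * (1 + ε) < #(G.branchSet ε c) ∧
    ∀ w ∈ G.branchSet ε c, ∀ v, G.Adj w v → G.IsWeak ε v → G.IsInner ε v

variable {G : SimpleGraph V} {L : V → Finset ℕ} {ε : ℝ} {k : ℕ}

theorem sum_degree_le_of_isWeak (hε : 0 < ε) (hε' : ε ≤ 1 / 20) (hk : 3 / ε ^ 2 ≤ (k : ℝ)) {v : V}
    (hv : G.IsWeak ε v) : ∑ z ∈ G.neighborFinset v, G.degree z ≤ k := by
  have h : (∑ z ∈ G.neighborFinset v, (G.degree z : ℝ)) ≤ #(G.neighborFinset v) • (3 / ε) :=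
    sum_le_card_nsmul _ _ _ fun z hz =>
      (lt_of_not_ge (hv.2 z ((G.mem_neighborFinset v z).1 hz))).le
  rw [card_neighborFinset_eq_degree, hv.1, nsmul_eq_mul] at h
  have h2 : ((2 : ℕ) : ℝ) * (3 / ε) ≤ 3 / ε ^ 2 := by
    rw [le_div_iff₀ (by positivity)]
    have : ((2 : ℕ) : ℝ) * (3 / ε) * ε ^ 2 = 6 * ε := by
      push_cast; field_simp; norm_num
    rw [this]; linarith
  have h3 := (h.trans h2).trans hk
  exact_mod_cast h3

theorem numLarge_add_numWeak_add_card (hε' : ε ≤ 1 / 20) (hε : 0 < ε) (v : V) :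
    G.numLarge ε v + G.numWeak ε v +
      #{u ∈ G.neighborFinset v | ¬ G.IsLarge ε u ∧ ¬ G.IsWeak ε u} = G.degree v := by
  have hdisj : ∀ u, G.IsLarge ε u → ¬ G.IsWeak ε u := by
    intro u h h'
    rw [IsLarge, h'.1, div_le_iff₀ hε] at h
    push_cast at h
    linarith
  have h1 := card_filter_add_card_filter_not (s := G.neighborFinset v) (fun u => G.IsLarge ε u)
  have h2 := card_filter_add_card_filter_not
    (s := (G.neighborFinset v).filter fun u => ¬ G.IsLarge ε u) (fun u => G.IsWeak ε u)
  rw [filter_filter, filter_filter] at h2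
  have h3 : {u ∈ G.neighborFinset v | ¬ G.IsLarge ε u ∧ G.IsWeak ε u} =
      {u ∈ G.neighborFinset v | G.IsWeak ε u} :=
    filter_congr fun u _ => ⟨fun h => h.2, fun h => ⟨fun h' => hdisj u h' h, h⟩⟩
  rw [h3] at h2
  rw [card_neighborFinset_eq_degree] at h1
  simp only [numLarge, numWeak]
  omega

/-- The data of a critical graph with a large number of colors. -/
structure IsSquareCriticalWith (G : SimpleGraph V) (L : V → Finset ℕ) (ε : ℝ) (k : ℕ) : Prop
    extends G.IsSquareCritical L where
  pos : 0 < ε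
  le : ε ≤ 1 / 20
  le_k : 3 / ε ^ 2 ≤ (k : ℝ)
  maxDegree_le : G.maxDegree ≤ k
  card_list : ∀ v, #(L v) = k + 1

namespace IsSquareCriticalWith

theorem degree_ne_one_vertex (h : G.IsSquareCriticalWith L ε k) (v : V) : G.degree v ≠ 1 :=
  h.toIsSquareCritical.degree_ne_one
    (fun v => by rw [h.card_list]; exact Nat.lt_succ_of_le h.maxDegree_le) v

theorem lt_sum_degree (h : G.IsSquareCriticalWith L ε k) {u v : V} (hv : G.IsWeak ε v)
    (huv : G.Adj v u) : k < ∑ z ∈ G.neighborFinset u, G.degree z := by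
  have := h.toIsSquareCritical.le_sum_degree_of_adj hv.1 huv (by
    rw [h.card_list]
    exact Nat.lt_succ_of_le (sum_degree_le_of_isWeak h.pos h.le h.le_k hv))
  rwa [h.card_list] at this

theorem not_isWeak_of_adj (h : G.IsSquareCriticalWith L ε k) {u v : V} (hv : G.IsWeak ε v)
    (huv : G.Adj v u) : ¬ G.IsWeak ε u := fun hu =>
  (h.lt_sum_degree hv huv).not_ge (sum_degree_le_of_isWeak h.pos h.le h.le_k hu)

/-- Small vertices that are neither weak nor branch vertices can pay all their weak neighbors. -/
theorem numWeak_mul_le (h : G.IsSquareCriticalWith L ε k) {u : V} (hd : 0 < G.degree u)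
    (hl : ¬ G.IsLarge ε u) (hw : ¬ G.IsWeak ε u) (hb : ¬ G.IsBranch ε u) :
    (G.numWeak ε u : ℝ) * (1 - ε) ≤ G.degree u - 3 + ε + G.numLarge ε u * (1 - ε) := by
  have hε := h.pos
  have hε' := h.le
  have hd2 : 2 ≤ G.degree u := by
    have := h.degree_ne_one_vertex u
    omega
  have hsum := numLarge_add_numWeak_add_card (G := G) hε' hε u
  set r := #{z ∈ G.neighborFinset u | ¬ G.IsLarge ε z ∧ ¬ G.IsWeak ε z} with hr
  have hsum' : (G.numLarge ε u : ℝ) + G.numWeak ε u + r = G.degree u := by exact_mod_cast hsum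
  have hd2' : (2 : ℝ) ≤ G.degree u := by exact_mod_cast hd2
  have hr0 : (0 : ℝ) ≤ r := by positivity
  have hw0 : (0 : ℝ) ≤ G.numWeak ε u := by positivity
  rcases Nat.lt_trichotomy (G.numLarge ε u) 1 with h0 | h1 | h2
  · have hℓ : G.numLarge ε u = 0 := by omega
    have hnl : ∀ z, G.Adj u z → ¬ G.IsLarge ε z := by
      intro z hz hzl
      rw [numLarge, card_eq_zero] at hℓ
      have : z ∈ ({z ∈ G.neighborFinset u | G.IsLarge ε z} : Finset V) :=
        mem_filter.2 ⟨(G.mem_neighborFinset u z).2 hz, hzl⟩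
      rw [hℓ] at this
      simp at this
    by_contra! hlt
    rw [hℓ] at hlt hsum'
    push_cast at hlt hsum'
    rcases Nat.eq_zero_or_pos (G.numWeak ε u) with hw0 | hwpos
    · rw [hw0] at hlt
      push_cast at hlt
      have h3 : G.degree u < 3 := by
        have : (G.degree u : ℝ) < 3 := by linarith
        exact_mod_cast this
      exact hw ⟨by omega, hnl⟩
    · obtain ⟨v, hv⟩ := card_pos.1 hwpos
      obtain ⟨hv1, hv2⟩ := mem_filter.1 hv
      have hk := h.lt_sum_degree hv2 ((G.mem_neighborFinset u v).1 hv1).symm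
      have hr4 : r ≤ 3 := by
        by_contra! hr4
        have hr4' : (4 : ℝ) ≤ r := by exact_mod_cast hr4
        nlinarith
      have hr4' : (r : ℝ) ≤ 3 := by exact_mod_cast hr4
      have hl' : (G.degree u : ℝ) < 3 / ε := lt_of_not_ge hl
      have hM : 0 < 3 / ε := by positivity
      have hsplit : ∑ z ∈ G.neighborFinset u, (G.degree z : ℝ) ≤
          ∑ z ∈ G.neighborFinset u, (2 + if ¬ G.IsLarge ε z ∧ ¬ G.IsWeak ε z then 3 / ε else 0) := by
        refine sum_le_sum fun z hz => ?_
        have hz' := hnl z ((G.mem_neighborFinset u z).1 hz)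
        by_cases hzw : G.IsWeak ε z
        · simp [hzw, hzw.1]
        · have : (G.degree z : ℝ) < 3 / ε := lt_of_not_ge hz'
          simp only [hz', hzw, not_false_eq_true, and_self, if_true]
          linarith
      rw [sum_add_distrib, sum_const, card_neighborFinset_eq_degree, ← sum_filter, sum_const, ← hr,
        nsmul_eq_mul, nsmul_eq_mul] at hsplit
      have hk' : (k : ℝ) < ∑ z ∈ G.neighborFinset u, (G.degree z : ℝ) := by exact_mod_cast hk
      have h15 : 5 * (3 / ε) ≤ 3 / ε ^ 2 := by
        rw [le_div_iff₀ (by positivity)]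
        have : 5 * (3 / ε) * ε ^ 2 = 15 * ε := by field_simp; norm_num
        rw [this]; linarith
      have := h.le_k
      nlinarith
  · rw [h1] at hsum' ⊢
    push_cast at hsum' ⊢
    rcases Nat.eq_zero_or_pos r with hr0 | hrpos
    · have : ¬ ((G.degree u : ℝ) - 1) * ε < 1 := fun hlt =>
        hb ⟨hl, hw, h1, by omega, hlt⟩
      rw [hr0] at hsum'
      push_cast at hsum'
      have hwe : (G.numWeak ε u : ℝ) = G.degree u - 1 := by linarith
      rw [hwe]
      nlinarith
    · have : (1 : ℝ) ≤ r := by exact_mod_cast hrpos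
      nlinarith
  · have h2' : (2 : ℝ) ≤ G.numLarge ε u := by exact_mod_cast h2
    nlinarith

theorem card_weak_le (h : G.IsSquareCriticalWith L ε k) :
    #{v | G.IsWeak ε v} ≤ #{v | G.IsInner ε v} +
      ∑ u with ¬ G.IsLarge ε u ∧ ¬ G.IsWeak ε u ∧ ¬ G.IsBranch ε u, G.numWeak ε u := by
  have hsub : ({v | G.IsWeak ε v} : Finset V) ⊆ ({v | G.IsInner ε v} : Finset V) ∪
      ({u | ¬ G.IsLarge ε u ∧ ¬ G.IsWeak ε u ∧ ¬ G.IsBranch ε u} : Finset V).biUnion fun u =>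
        {v ∈ G.neighborFinset u | G.IsWeak ε v} := by
    intro v hv
    have hv' := (mem_filter.1 hv).2
    simp only [mem_union, mem_biUnion, mem_filter, mem_univ, true_and, mem_neighborFinset]
    by_cases hi : G.IsInner ε v
    · exact Or.inl hi
    · right
      simp only [IsInner, hv', true_and, not_forall] at hi
      obtain ⟨u, hu, hub⟩ := hi
      exact ⟨u, ⟨hv'.2 u hu, h.not_isWeak_of_adj hv' hu, hub⟩, hu.symm, hv'⟩
  exact (card_le_card hsub).trans ((card_union_le _ _).trans
    (Nat.add_le_add_left card_biUnion_le _))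

end IsSquareCriticalWith

theorem sum_numLarge (G : SimpleGraph V) (ε : ℝ) :
    ∑ v, G.numLarge ε v = ∑ y with G.IsLarge ε y, G.degree y := by
  have := sum_card_bipartiteAbove_eq_sum_card_bipartiteBelow (s := (univ : Finset V))
    (t := ({y | G.IsLarge ε y} : Finset V)) G.Adj
  refine Eq.trans (sum_congr rfl fun v _ => ?_) (this.trans (sum_congr rfl fun y _ => ?_))
  · rw [numLarge, bipartiteAbove]
    congr 1
    ext u
    simp [and_comm]
  · rw [← card_neighborFinset_eq_degree, bipartiteBelow]
    congr 1
    ext u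
    simp [adj_comm]

theorem IsSquareCriticalWith.charge_le (h : G.IsSquareCriticalWith L ε k) :
    (∑ y with G.IsLarge ε y, ((G.degree y : ℝ) * ε - 3 + ε)) +
      (∑ w with G.IsBranch ε w, ((G.degree w : ℝ) - 2)) - #{v | G.IsInner ε v} * (1 - ε) ≤
    ∑ v with 0 < G.degree v, ((G.degree v : ℝ) - 3 + ε) := by
  have hε := h.pos
  have hε' := h.le
  have hlarge : ∀ v, G.IsLarge ε v → 60 ≤ (G.degree v : ℝ) := by
    intro v hv
    refine le_trans ?_ hv
    rw [le_div_iff₀ hε]; linarith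
  have hpoint : ∀ v, (if G.IsLarge ε v then ((G.degree v : ℝ) * ε - 3 + ε) else 0) +
      (if G.IsBranch ε v then ((G.degree v : ℝ) - 2) else 0) - (if G.IsWeak ε v then (1 - ε) else 0)
      + (if ¬ G.IsLarge ε v ∧ ¬ G.IsWeak ε v ∧ ¬ G.IsBranch ε v then (G.numWeak ε v : ℝ) else 0)
        * (1 - ε) ≤
      (if 0 < G.degree v then ((G.degree v : ℝ) - 3 + ε) else 0) + (G.numLarge ε v : ℝ) * (1 - ε)
        - (if G.IsLarge ε v then (G.degree v : ℝ) else 0) * (1 - ε) := by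
    intro v
    have hℓ0 : (0 : ℝ) ≤ G.numLarge ε v := by positivity
    have hℓ1 : 0 ≤ (G.numLarge ε v : ℝ) * (1 - ε) := mul_nonneg hℓ0 (by linarith)
    by_cases hl : G.IsLarge ε v
    · have h60 := hlarge v hl
      have hw : ¬ G.IsWeak ε v := by
        intro hw
        rw [hw.1] at h60
        norm_num at h60
      have hb : ¬ G.IsBranch ε v := fun hb => hb.1 hl
      have hd : 0 < G.degree v := by
        have : (0 : ℝ) < G.degree v := by linarith
        exact_mod_cast this
      simp only [hl, hw, hb, hd, if_true, if_false, not_true, false_and]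
      linarith
    by_cases hw : G.IsWeak ε v
    · have hb : ¬ G.IsBranch ε v := fun hb => hb.2.1 hw
      have hd : 0 < G.degree v := by rw [hw.1]; norm_num
      simp only [hl, hw, hb, hd, if_true, if_false, not_true, false_and, and_false]
      rw [hw.1]
      push_cast
      linarith
    by_cases hb : G.IsBranch ε v
    · have hd : 0 < G.degree v := by have := hb.2.2.2.1; omega
      simp only [hl, hw, hb, hd, if_true, if_false, not_true, and_false]
      rw [hb.2.2.1]
      push_cast
      linarith
    by_cases hd : 0 < G.degree v
    · have := h.numWeak_mul_le hd hl hw hb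
      simp only [hl, hw, hb, hd, if_true, if_false, not_false_eq_true, and_self]
      linarith
    · have hz : G.numWeak ε v = 0 := by
        rw [numWeak, card_eq_zero, filter_eq_empty_iff]
        intro u hu
        exact absurd (card_pos.2 ⟨u, hu⟩) (by rwa [card_neighborFinset_eq_degree])
      simp only [hl, hw, hb, hd, if_true, if_false, not_false_eq_true, and_self, hz]
      push_cast
      linarith
  have hsum := sum_le_sum fun v (_ : v ∈ (univ : Finset V)) => hpoint v
  simp only [sum_add_distrib, sum_sub_distrib, ← sum_mul, ← sum_filter] at hsum
  have h1 : ∑ v, (G.numLarge ε v : ℝ) = ∑ y with G.IsLarge ε y, (G.degree y : ℝ) := by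
    exact_mod_cast sum_numLarge G ε
  have h2 : (#{v | G.IsWeak ε v} : ℝ) ≤ #{v | G.IsInner ε v} +
      ∑ u with ¬ G.IsLarge ε u ∧ ¬ G.IsWeak ε u ∧ ¬ G.IsBranch ε u, (G.numWeak ε u : ℝ) := by
    exact_mod_cast h.card_weak_le
  rw [h1] at hsum
  have h3 := mul_le_mul_of_nonneg_right h2 (by linarith : 0 ≤ 1 - ε)
  simp only [sum_add_distrib, sum_sub_distrib, sum_const, nsmul_eq_mul, ← sum_mul] at hsum ⊢
  linarith

end SimpleGraph

namespace SimpleGraph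

open scoped Classical

variable {V : Type*} [Fintype V] {G : SimpleGraph V} {L : V → Finset ℕ} {ε : ℝ} {k : ℕ}

theorem Reachable.exists_adj_dist_lt {V : Type*} {H : SimpleGraph V} {u r : V}
    (h : H.Reachable u r) (hne : u ≠ r) : ∃ w, H.Adj u w ∧ H.dist w r < H.dist u r := by
  obtain ⟨p, hp⟩ := h.exists_walk_length_eq_dist
  cases p with
  | nil => exact absurd rfl hne
  | cons huw p =>
    refine ⟨_, huw, ?_⟩
    rw [← hp, Walk.length_cons]
    exact Nat.lt_succ_of_le (dist_le p)

theorem IsInner.connectedComponentMk_eq {v a b : V} (hv : G.IsInner ε v) (ha : G.Adj v a)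
    (hb : G.Adj v b) : (G.branchGraph ε).connectedComponentMk a =
      (G.branchGraph ε).connectedComponentMk b := by
  by_cases hab : a = b
  · rw [hab]
  · exact ConnectedComponent.sound (Adj.reachable ⟨hab, hv.2 a ha, hv.2 b hb, v, hv.1, ha, hb⟩)

theorem IsWeak.eq_or_eq {v a b c : V} (hv : G.IsWeak ε v) (ha : G.Adj v a) (hb : G.Adj v b)
    (hab : a ≠ b) (hc : G.Adj v c) : c = a ∨ c = b := by
  by_contra! h
  have hsub : ({a, b, c} : Finset V) ⊆ G.neighborFinset v := by
    intro z hz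
    simp only [mem_insert, mem_singleton] at hz
    rw [mem_neighborFinset]
    rcases hz with rfl | rfl | rfl <;> assumption
  have := card_le_card hsub
  rw [card_neighborFinset_eq_degree, hv.1,
    card_eq_three.2 ⟨a, b, c, hab, h.1.symm, h.2.symm, rfl⟩] at this
  omega

theorem IsBranch.not_isLarge_iff_isWeak {w v : V} (hw : G.IsBranch ε w) (hε : 0 < ε)
    (hε' : ε ≤ 1 / 20) (hv : G.Adj w v) : ¬ G.IsLarge ε v ↔ G.IsWeak ε v := by
  have h1 := numLarge_add_numWeak_add_card (G := G) hε' hε w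
  have h2 := hw.2.2.1
  have h3 := hw.2.2.2.1
  have h4 : #{u ∈ G.neighborFinset w | ¬ G.IsLarge ε u ∧ ¬ G.IsWeak ε u} = 0 := by omega
  rw [card_eq_zero, filter_eq_empty_iff] at h4
  have h5 := h4 ((G.mem_neighborFinset w v).2 hv)
  refine ⟨fun h => by tauto, fun h hl => ?_⟩
  rw [IsLarge, h.1, div_le_iff₀ hε] at hl
  push_cast at hl
  linarith

theorem card_branchSet_le (c : (G.branchGraph ε).ConnectedComponent) :
    #(G.branchSet ε c) ≤ #(G.innerSet ε c) + 1 := by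
  rcases (G.branchSet ε c).eq_empty_or_nonempty with h0 | ⟨r, hr⟩
  · simp [h0]
  have hrc := (mem_filter.1 hr).2
  have hex : ∀ w ∈ (G.branchSet ε c).erase r, ∃ v u, G.IsWeak ε v ∧ G.Adj v w ∧ G.Adj v u ∧
      w ≠ u ∧ G.IsBranch ε w ∧ G.IsBranch ε u ∧
      (G.branchGraph ε).dist u r < (G.branchGraph ε).dist w r := by
    intro w hw
    obtain ⟨hwr, hw⟩ := mem_erase.1 hw
    have hwc := (mem_filter.1 hw).2
    obtain ⟨u, ⟨hne, hb, hb', v, hv, h1, h2⟩, hlt⟩ :=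
      (ConnectedComponent.exact (hwc.2.trans hrc.2.symm)).exists_adj_dist_lt hwr
    exact ⟨v, u, hv, h1, h2, hne, hb, hb', hlt⟩
  choose! v u hweak hvw hvu hne hbw hbu hlt using hex
  have hcard : #((G.branchSet ε c).erase r) ≤ #(G.innerSet ε c) := by
    refine card_le_card_of_injOn v (fun w hw => ?_) fun w hw w' hw' hww => ?_
    · refine mem_coe.2 (mem_filter.2 ⟨mem_univ _, ⟨hweak w hw, fun z hz => ?_⟩, w, hvw w hw,
        (mem_filter.1 (mem_of_mem_erase (mem_coe.1 hw))).2.2⟩)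
      rcases (hweak w hw).eq_or_eq (hvw w hw) (hvu w hw) (hne w hw) hz with rfl | rfl
      · exact hbw _ hw
      · exact hbu _ hw
    · by_contra hn
      have h1 : w' = u w := by
        have := (hweak w hw).eq_or_eq (hvw w hw) (hvu w hw) (hne w hw)
          (by rw [hww]; exact hvw w' hw')
        tauto
      have h2 : w = u w' := by
        have := (hweak w' hw').eq_or_eq (hvw w' hw') (hvu w' hw') (hne w' hw')
          (by rw [← hww]; exact hvw w hw)
        tauto
      have h3 := hlt w hw
      have h4 := hlt w' hw'
      rw [← h1] at h3
      rw [← h2] at h4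
      omega
  rw [card_erase_of_mem hr] at hcard
  omega

theorem card_innerSet_double (c : (G.branchGraph ε).ConnectedComponent) :
    ∑ w ∈ G.branchSet ε c, #{v ∈ G.innerSet ε c | G.Adj w v} = 2 * #(G.innerSet ε c) := by
  have := sum_card_bipartiteAbove_eq_sum_card_bipartiteBelow (s := G.branchSet ε c)
    (t := G.innerSet ε c) G.Adj
  refine this.trans ?_
  rw [mul_comm, ← smul_eq_mul, ← sum_const]
  refine sum_congr rfl fun v hv => ?_
  obtain ⟨-, hi, u, hu, huc⟩ := mem_filter.1 hv
  rw [← hi.1.1, ← card_neighborFinset_eq_degree, bipartiteBelow]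
  congr 1
  ext w
  simp only [mem_filter, mem_neighborFinset, branchSet, mem_univ, true_and]
  refine ⟨fun h => h.2.symm, fun h => ⟨⟨hi.2 w h, ?_⟩, h.symm⟩⟩
  rw [← huc]
  exact hi.connectedComponentMk_eq h hu

theorem filter_innerSet_subset (w : V) (c : (G.branchGraph ε).ConnectedComponent) :
    {v ∈ G.innerSet ε c | G.Adj w v} ⊆ {v ∈ G.neighborFinset w | G.IsWeak ε v} := by
  intro v hv
  obtain ⟨hv1, hv2⟩ := mem_filter.1 hv
  exact mem_filter.2 ⟨(G.mem_neighborFinset w v).2 hv2, (mem_filter.1 hv1).2.1.1⟩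

/-- The branch vertices of a component can pay its inner vertices, up to one unit of charge if the
component is poor. -/
theorem card_innerSet_mul_le (hε : 0 < ε) (c : (G.branchGraph ε).ConnectedComponent) :
    (#(G.innerSet ε c) : ℝ) * (1 - ε) ≤
      (∑ w ∈ G.branchSet ε c, ((G.degree w : ℝ) - 2)) + if G.IsPoor ε c then 1 else 0 := by
  have hle : ∀ w ∈ G.branchSet ε c, #{v ∈ G.innerSet ε c | G.Adj w v} + 1 ≤ G.degree w := by
    intro w hw
    rw [← (mem_filter.1 hw).2.1.2.2.2.1]
    exact Nat.succ_le_succ (card_le_card (filter_innerSet_subset w c))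
  have h2 := card_innerSet_double c
  have hn := card_branchSet_le c
  have hn' : (#(G.branchSet ε c) : ℝ) ≤ #(G.innerSet ε c) + 1 := by exact_mod_cast hn
  have he : (0 : ℝ) ≤ #(G.innerSet ε c) := by positivity
  rw [sum_sub_distrib, sum_const, nsmul_eq_mul]
  have hsum : 2 * #(G.innerSet ε c) + #(G.branchSet ε c) ≤ ∑ w ∈ G.branchSet ε c, G.degree w := by
    rw [← h2, card_eq_sum_ones, ← sum_add_distrib]
    exact sum_le_sum hle
  have hsum' : 2 * (#(G.innerSet ε c) : ℝ) + #(G.branchSet ε c) ≤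
      ∑ w ∈ G.branchSet ε c, (G.degree w : ℝ) := by exact_mod_cast hsum
  by_cases hp : G.IsPoor ε c
  · rw [if_pos hp]
    nlinarith
  · rw [if_neg hp]
    by_cases hlt : (#(G.innerSet ε c) : ℝ) * (1 + ε) < #(G.branchSet ε c)
    · simp only [IsPoor, hlt, true_and, not_forall] at hp
      obtain ⟨w, hw, v, hwv, hv, hvi⟩ := hp
      have hsum2 : 2 * #(G.innerSet ε c) + #(G.branchSet ε c) <
          ∑ w ∈ G.branchSet ε c, G.degree w := by
        rw [← h2, card_eq_sum_ones, ← sum_add_distrib]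
        refine sum_lt_sum hle ⟨w, hw, ?_⟩
        rw [← (mem_filter.1 hw).2.1.2.2.2.1]
        refine Nat.succ_lt_succ (card_lt_card
          ((filter_innerSet_subset w c).ssubset_of_mem_notMem (a := v) ?_ ?_))
        · exact mem_filter.2 ⟨(G.mem_neighborFinset w v).2 hwv, hv⟩
        · exact fun h => hvi (mem_filter.1 (mem_filter.1 h).1).2.1
      have hsum3 : 2 * (#(G.innerSet ε c) : ℝ) + #(G.branchSet ε c) + 1 ≤
          ∑ w ∈ G.branchSet ε c, (G.degree w : ℝ) := by exact_mod_cast hsum2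
      nlinarith
    · nlinarith

theorem IsPoor.card_lt (hε : 0 < ε) {c : (G.branchGraph ε).ConnectedComponent}
    (hc : G.IsPoor ε c) : (#(G.branchSet ε c) : ℝ) < 1 + 1 / ε := by
  have hn' : (#(G.branchSet ε c) : ℝ) ≤ #(G.innerSet ε c) + 1 := by
    exact_mod_cast card_branchSet_le c
  have h1 := hc.1
  have h2 : (#(G.innerSet ε c) : ℝ) < 1 / ε := by
    rw [lt_div_iff₀ hε]
    linarith
  linarith

theorem IsPoor.branchSet_nonempty (hε : 0 < ε) {c : (G.branchGraph ε).ConnectedComponent}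
    (hc : G.IsPoor ε c) : (G.branchSet ε c).Nonempty := by
  rw [← card_pos]
  have h1 := hc.1
  have : (0 : ℝ) < #(G.branchSet ε c) := lt_of_le_of_lt (by positivity) h1
  exact_mod_cast this

/-- The deficit of all components together. -/
theorem card_isInner_mul_le (hε : 0 < ε) (hε' : ε ≤ 1 / 20) :
    (#{v | G.IsInner ε v} : ℝ) * (1 - ε) ≤
      (∑ w with G.IsBranch ε w, ((G.degree w : ℝ) - 2)) +
        #{c : (G.branchGraph ε).ConnectedComponent | G.IsPoor ε c} := by
  have h1 : #{v | G.IsInner ε v} ≤ ∑ c, #(G.innerSet ε c) := by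
    refine (card_le_card fun v hv => ?_).trans card_biUnion_le
    have hv' := (mem_filter.1 hv).2
    have : 0 < #(G.neighborFinset v) := by rw [card_neighborFinset_eq_degree, hv'.1.1]; norm_num
    obtain ⟨u, hu⟩ := card_pos.1 this
    exact mem_biUnion.2 ⟨(G.branchGraph ε).connectedComponentMk u, mem_univ _,
      mem_filter.2 ⟨mem_univ _, hv', u, (G.mem_neighborFinset v u).1 hu, rfl⟩⟩
  have h1' : (#{v | G.IsInner ε v} : ℝ) ≤ ∑ c, (#(G.innerSet ε c) : ℝ) := by exact_mod_cast h1
  have h2 : ∑ w with G.IsBranch ε w, ((G.degree w : ℝ) - 2) =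
      ∑ c, ∑ w ∈ G.branchSet ε c, ((G.degree w : ℝ) - 2) := by
    rw [← sum_fiberwise (g := (G.branchGraph ε).connectedComponentMk)]
    refine sum_congr rfl fun c _ => sum_congr ?_ fun _ _ => rfl
    rw [branchSet, filter_filter]
  have h3 := sum_le_sum fun c (_ : c ∈ (univ : Finset (G.branchGraph ε).ConnectedComponent)) =>
    card_innerSet_mul_le (G := G) hε c
  rw [sum_add_distrib, ← h2, ← sum_mul, sum_boole] at h3
  exact (mul_le_mul_of_nonneg_right h1' (by linarith)).trans h3

end SimpleGraph

/-- If every nonempty subfamily of `B` meets some `y ∈ Y` in at most `c` members, then `B` has at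
most `c * #Y` members. -/
theorem Finset.card_le_mul_card_of_peel {α β : Type*} [DecidableEq α] (r : α → β → Prop)
    [∀ a b, Decidable (r a b)] (B : Finset α) (Y : Finset β) (c : ℝ) (hc : 0 ≤ c)
    (h : ∀ T ⊆ B, T.Nonempty → ∃ y ∈ Y, (∃ a ∈ T, r a y) ∧ (#{a ∈ T | r a y} : ℝ) ≤ c) :
    (#B : ℝ) ≤ c * #Y := by
  classical
  have key : ∀ T ⊆ B, (#T : ℝ) ≤ c * #{y ∈ Y | ∃ a ∈ T, r a y} := by
    intro T
    induction T using Finset.strongInduction with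
    | H T ih =>
    intro hT
    rcases T.eq_empty_or_nonempty with rfl | hne
    · simp
    obtain ⟨y, hy, ⟨a, ha, hay⟩, hle⟩ := h T hT hne
    have hss : T.filter (fun a => ¬ r a y) ⊂ T :=
      (filter_subset _ _).ssubset_of_mem_notMem ha (by simp [hay])
    have h1 := ih _ hss (hss.subset.trans hT)
    have h2 := card_filter_add_card_filter_not (s := T) (fun a => r a y)
    have h2' : (#{a ∈ T | r a y} : ℝ) + #{a ∈ T | ¬ r a y} = #T := by exact_mod_cast h2
    have h3 : #{z ∈ Y | ∃ a ∈ T.filter (fun a => ¬ r a y), r a z} + 1 ≤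
        #{z ∈ Y | ∃ a ∈ T, r a z} := by
      refine card_lt_card (LE.le.ssubset_of_mem_notMem (a := y) ?_ ?_ ?_)
      · intro z hz
        obtain ⟨hz1, b, hb, hbz⟩ := mem_filter.1 hz
        exact mem_filter.2 ⟨hz1, b, (mem_filter.1 hb).1, hbz⟩
      · exact mem_filter.2 ⟨hy, a, ha, hay⟩
      · intro hz
        obtain ⟨-, b, hb, hbz⟩ := mem_filter.1 hz
        exact (mem_filter.1 hb).2 hbz
    have h3' : (#{z ∈ Y | ∃ a ∈ T.filter (fun a => ¬ r a y), r a z} : ℝ) + 1 ≤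
        #{z ∈ Y | ∃ a ∈ T, r a z} := by exact_mod_cast h3
    nlinarith
  refine (key B Subset.rfl).trans (mul_le_mul_of_nonneg_left ?_ hc)
  exact_mod_cast card_le_card (filter_subset _ _)

namespace SimpleGraph

open scoped Classical

variable {V : Type*} [Fintype V] {G : SimpleGraph V} {L : V → Finset ℕ} {ε : ℝ} {k : ℕ}

namespace IsSquareCriticalWith

/-- The large neighbor of a branch vertex has almost maximum degree. -/
theorem lt_degree_of_isBranch (h : G.IsSquareCriticalWith L ε k) {w y : V} (hw : G.IsBranch ε w)
    (hy : ∀ z, G.Adj w z → G.IsLarge ε z → z = y) : (k : ℝ) - 2 / ε < G.degree y := by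
  have h1 := hw.2.2.2.1
  have hpos : 0 < G.numWeak ε w := by
    have := h.degree_ne_one_vertex w
    have h3 : 0 < G.numLarge ε w := by rw [hw.2.2.1]; norm_num
    have h4 := numLarge_add_numWeak_add_card (G := G) h.le h.pos w
    omega
  obtain ⟨v, hv⟩ := card_pos.1 hpos
  obtain ⟨hv1, hv2⟩ := mem_filter.1 hv
  have hk := h.lt_sum_degree hv2 ((G.mem_neighborFinset w v).1 hv1).symm
  have hsub : G.neighborFinset w ⊆ {y} ∪ {z ∈ G.neighborFinset w | G.IsWeak ε z} := by
    intro z hz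
    have hz' := (G.mem_neighborFinset w z).1 hz
    by_cases hl : G.IsLarge ε z
    · exact mem_union_left _ (mem_singleton.2 (hy z hz' hl))
    · exact mem_union_right _ (mem_filter.2
        ⟨hz, (hw.not_isLarge_iff_isWeak h.pos h.le hz').1 hl⟩)
  have h5 : ∑ z ∈ G.neighborFinset w, G.degree z ≤ G.degree y + G.numWeak ε w * 2 := by
    refine (sum_le_sum_of_subset hsub).trans ((Nat.le.intro sum_union_inter).trans ?_)
    rw [sum_singleton]
    refine Nat.add_le_add_left ?_ _
    rw [← smul_eq_mul]
    exact sum_le_card_nsmul _ _ _ fun z hz => (mem_filter.1 hz).2.1.le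
  have h6 : (k : ℝ) < G.degree y + G.numWeak ε w * 2 := by exact_mod_cast hk.trans_le h5
  have h7 : (G.numWeak ε w : ℝ) < 1 / ε := by
    rw [lt_div_iff₀ h.pos]
    have h8 := hw.2.2.2.2
    rw [← h1] at h8
    push_cast at h8
    linarith
  have h9 : (2 : ℝ) / ε = 2 * (1 / ε) := by ring
  rw [h9]
  linarith

/-- A family of poor components is only sparsely attached to some large vertex. -/
theorem exists_large_of_isPoor (h : G.IsSquareCriticalWith L ε k)
    (T : Finset (G.branchGraph ε).ConnectedComponent) (hT : T.Nonempty)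
    (hpoor : ∀ c ∈ T, G.IsPoor ε c) :
    ∃ y, (G.IsLarge ε y ∧ (k : ℝ) - 2 / ε < G.degree y) ∧
      (∃ c ∈ T, ∃ w ∈ G.branchSet ε c, G.Adj w y) ∧
      (#{c ∈ T | ∃ w ∈ G.branchSet ε c, G.Adj w y} : ℝ) ≤ 1 + 1 / ε := by
  have hlarge : ∀ w, ∃ y, G.IsBranch ε w → ∀ z, (G.Adj w z ∧ G.IsLarge ε z) ↔ z = y := by
    intro w
    by_cases hw : G.IsBranch ε w
    · obtain ⟨y, hy⟩ := card_eq_one.1 hw.2.2.1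
      refine ⟨y, fun _ z => ?_⟩
      rw [← mem_singleton, ← hy, mem_filter, mem_neighborFinset]
    · exact ⟨w, fun hw' => absurd hw' hw⟩
  choose y hy using hlarge
  let t := (G.branchGraph ε).connectedComponentMk
  set U : Finset V := {w | G.IsBranch ε w ∧ t w ∈ T} with hU
  have hUb : ∀ {w}, w ∈ U → G.IsBranch ε w := fun hw => (mem_filter.1 hw).2.1
  have hUt : ∀ {w}, w ∈ U → t w ∈ T := fun hw => (mem_filter.1 hw).2.2
  have hmemU : ∀ {w}, G.IsBranch ε w → t w ∈ T → w ∈ U := fun h1 h2 =>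
    mem_filter.2 ⟨mem_univ _, h1, h2⟩
  have hUset : ∀ {w}, w ∈ U → w ∈ G.branchSet ε (t w) := fun hw =>
    mem_filter.2 ⟨mem_univ _, hUb hw, rfl⟩
  have hyadj : ∀ {w}, w ∈ U → G.Adj w (y w) := fun hw => ((hy _ (hUb hw) _).2 rfl).1
  have hylarge : ∀ {w}, w ∈ U → G.IsLarge ε (y w) := fun hw => ((hy _ (hUb hw) _).2 rfl).2
  have hinner : ∀ {w z}, w ∈ U → G.Adj w z → z ≠ y w → G.IsInner ε z := by
    intro w z hw hwz hzy
    refine (hpoor _ (hUt hw)).2 w (hUset hw) z hwz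
      (((hUb hw).not_isLarge_iff_isWeak h.pos h.le hwz).1 fun hl => hzy ?_)
    exact (hy w (hUb hw) z).1 ⟨hwz, hl⟩
  have hinnerU : ∀ {w z b}, w ∈ U → G.IsInner ε z → G.Adj w z → G.Adj z b → b ∈ U ∧ t w = t b := by
    intro w z b hw hz hwz hzb
    have hwb : t w = t b := hz.connectedComponentMk_eq hwz.symm hzb
    exact ⟨hmemU (hz.2 b hzb) (hwb ▸ hUt hw), hwb⟩
  by_contra! hcon
  have hmany : ∀ w ∈ U, (1 : ℝ) + 1 / ε < #{a ∈ U | y a = y w} := by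
    intro w hw
    refine lt_of_lt_of_le (hcon (y w) ⟨hylarge hw, h.lt_degree_of_isBranch (hUb hw)
      fun z h1 h2 => (hy w (hUb hw) z).1 ⟨h1, h2⟩⟩ ⟨t w, hUt hw, w, hUset hw, hyadj hw⟩) ?_
    have hsub : {c ∈ T | ∃ a ∈ G.branchSet ε c, G.Adj a (y w)} ⊆
        ({a ∈ U | y a = y w}).image t := by
      intro c hc
      obtain ⟨hcT, a, ha, haw⟩ := mem_filter.1 hc
      obtain ⟨-, hab, hac⟩ := mem_filter.1 ha
      exact mem_image.2 ⟨a, mem_filter.2 ⟨hmemU hab (by rw [show t a = c from hac]; exact hcT),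
        ((hy a hab _).1 ⟨haw, hylarge hw⟩).symm⟩, hac⟩
    exact_mod_cast (card_le_card hsub).trans card_image_le
  set W : Finset V := {v | G.IsInner ε v ∧ ∃ u ∈ U, G.Adj v u} with hW
  have hUW : ∀ {w}, w ∈ U → w ∉ W := fun hw hw' =>
    (hUb hw).2.1 (mem_filter.1 hw').2.1.1
  have hWU : ∀ {v a}, v ∈ W → G.Adj v a → a ∈ U := by
    intro v a hv hva
    obtain ⟨-, hvi, u, hu, hvu⟩ := mem_filter.1 hv
    exact (hinnerU hu hvi hvu.symm hva).1
  have hWne : ∃ w ∈ (W : Set V), ∃ u, G.Adj w u := by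
    obtain ⟨c, hc⟩ := hT
    obtain ⟨w, hw⟩ := (hpoor c hc).branchSet_nonempty h.pos
    have hwb := (mem_filter.1 hw).2
    have h1 := hwb.1.2.2.2.1
    have h2 := h.degree_ne_one_vertex w
    have h3 := hwb.1.2.2.1
    have h4 := numLarge_add_numWeak_add_card (G := G) h.le h.pos w
    have hpos : 0 < G.numWeak ε w := by omega
    obtain ⟨v, hv⟩ := card_pos.1 hpos
    obtain ⟨hv1, hv2⟩ := mem_filter.1 hv
    have hwv := (G.mem_neighborFinset w v).1 hv1
    exact ⟨v, mem_coe.2 (mem_filter.2 ⟨mem_univ _, (hpoor c hc).2 w hw v hwv hv2, w,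
      hmemU hwb.1 (by rw [show t w = c from hwb.2]; exact hc), hwv.symm⟩), w, hwv.symm⟩
  obtain ⟨C₀, hC₀⟩ := h.toIsSquareCritical.exists_partial (W := W) (R := W ∪ U)
    Set.subset_union_left hWne
    (fun v hv a ha b _ hva _ => absurd (Or.inr (hWU (mem_coe.1 hv) hva)) ha)
  let L' : V → Finset ℕ := fun w =>
    L w \ (insert (y w) (G.neighborFinset (y w) \ U)).image C₀
  have hL' : ∀ w ∈ U, #{a ∈ U | y a = y w} ≤ #(L' w) := by
    intro w hw
    have h1 := le_card_sdiff ((insert (y w) (G.neighborFinset (y w) \ U)).image C₀) (L w)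
    have h2 : #((insert (y w) (G.neighborFinset (y w) \ U)).image C₀) ≤
        #(G.neighborFinset (y w) \ U) + 1 := card_image_le.trans (card_insert_le _ _)
    have h3 := card_sdiff_add_card_inter (G.neighborFinset (y w)) U
    rw [card_neighborFinset_eq_degree] at h3
    have h4 : #{a ∈ U | y a = y w} ≤ #(G.neighborFinset (y w) ∩ U) := by
      refine card_le_card fun a ha => ?_
      obtain ⟨ha1, ha2⟩ := mem_filter.1 ha
      exact mem_inter.2 ⟨(G.mem_neighborFinset _ _).2 (ha2 ▸ (hyadj ha1).symm), ha1⟩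
    have h5 := (G.degree_le_maxDegree (y w)).trans h.maxDegree_le
    rw [h.card_list] at h1
    simp only [L']
    omega
  obtain ⟨C₁, hC₁L, hC₁⟩ := exists_list_edge_coloring y t U L' (by
    intro w hw
    have h1 := (hpoor _ (hUt hw)).card_lt h.pos
    have h2 : {a ∈ U | t a = t w} ⊆ G.branchSet ε (t w) := by
      intro a ha
      obtain ⟨ha1, ha2⟩ := mem_filter.1 ha
      exact mem_filter.2 ⟨mem_univ _, hUb ha1, ha2⟩
    have h3 := hmany w hw
    have h4 : (#(G.branchSet ε (t w)) : ℝ) < #{a ∈ U | y a = y w} := h1.trans h3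
    exact (card_le_card h2).trans (by exact_mod_cast h4.le)) hL'
  have hcross : ∀ a ∈ U, ∀ b, b ∉ U → b ∉ W → G.square.Adj a b → C₁ a ≠ C₀ b := by
    intro a ha b hbU hbW hab heq
    refine (mem_sdiff.1 (hC₁L a ha)).2 (mem_image.2 ⟨b, ?_, heq.symm⟩)
    rcases hab.2 with hab | ⟨z, haz, hzb⟩
    · by_cases hby : b = y a
      · rw [hby]; exact mem_insert_self _ _
      · exact absurd (mem_filter.2 ⟨mem_univ _, hinner ha hab hby, a, ha, hab.symm⟩) hbW
    · by_cases hzy : z = y a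
      · rw [← hzy]
        exact mem_insert_of_mem (mem_sdiff.2 ⟨(G.mem_neighborFinset z b).2 hzb, hbU⟩)
      · exact absurd (hinnerU ha (hinner ha haz hzy) haz hzb).1 hbU
  have hpart : G.IsPartialListColoring L (W : Set V)ᶜ fun v => if v ∈ U then C₁ v else C₀ v := by
    refine ⟨fun v hv => ?_, fun a ha b hb hab => ?_⟩
    · by_cases hvU : v ∈ U
      · simpa [hvU] using (mem_sdiff.1 (hC₁L v hvU)).1
      · simpa [hvU] using hC₀.1 v fun hv' => hv'.elim hv hvU
    · by_cases haU : a ∈ U <;> by_cases hbU : b ∈ U <;> simp only [haU, hbU, if_true, if_false]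
      · refine hC₁ a haU b hbU hab.1 ?_
        rcases hab.2 with hab | ⟨z, haz, hzb⟩
        · exfalso
          by_cases hby : b = y a
          · exact (hUb hbU).1 (hby ▸ hylarge haU)
          · exact (hUb hbU).2.1 (hinner haU hab hby).1
        · by_cases hzy : z = y a
          · left
            rw [← hzy]
            exact (hy b (hUb hbU) z).1 ⟨hzb.symm, hzy ▸ hylarge haU⟩
          · exact Or.inr (hinnerU haU (hinner haU haz hzy) haz hzb).2
      · exact hcross a haU b hbU hb hab
      · exact (hcross b hbU a haU ha hab.symm).symm
      · exact hC₀.2 a (fun ha' => ha'.elim ha haU) b (fun hb' => hb'.elim hb hbU) hab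
  obtain ⟨C₂, hC₂⟩ := hpart.union W fun v hv => by
    rw [h.card_list]
    exact Nat.lt_succ_of_le
      (sum_degree_le_of_isWeak h.pos h.le h.le_k (mem_filter.1 hv).2.1.1)
  rw [Set.compl_union_self] at hC₂
  exact h.not_colorable C₂ hC₂

/-- A critical graph is not sparse. -/
theorem zero_le_sum (h : G.IsSquareCriticalWith L ε k) :
    0 ≤ ∑ v with 0 < G.degree v, ((G.degree v : ℝ) - 3 + ε) := by
  refine le_trans ?_ h.charge_le
  have hε := h.pos
  have h1 := card_isInner_mul_le (G := G) h.pos h.le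
  have hinv : (20 : ℝ) ≤ 1 / ε := by
    rw [le_div_iff₀ hε]; linarith [h.le]
  have h2 := card_le_mul_card_of_peel (fun c y => ∃ w ∈ G.branchSet ε c, G.Adj w y)
    ({c | G.IsPoor ε c} : Finset (G.branchGraph ε).ConnectedComponent)
    ({y | G.IsLarge ε y ∧ (k : ℝ) - 2 / ε < G.degree y} : Finset V) (1 + 1 / ε) (by linarith) (by
      intro T hT hne
      obtain ⟨y, hy, h3, h4⟩ := h.exists_large_of_isPoor T hne fun c hc => (mem_filter.1 (hT hc)).2
      exact ⟨y, mem_filter.2 ⟨mem_univ _, hy⟩, h3, h4⟩)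
  have h3 : (1 + 1 / ε) * (#{y | G.IsLarge ε y ∧ (k : ℝ) - 2 / ε < G.degree y} : ℝ) ≤
      ∑ y with G.IsLarge ε y, ((G.degree y : ℝ) * ε - 3 + ε) := by
    rw [mul_comm, ← nsmul_eq_mul, ← sum_const]
    refine (sum_le_sum fun y hy => ?_).trans (sum_le_sum_of_subset_of_nonneg
      (t := ({y | G.IsLarge ε y} : Finset V)) (fun y hy => ?_) fun y hy _ => ?_)
    · have h5 := (mem_filter.1 hy).2.2
      have h6 := mul_lt_mul_of_pos_right h5 hε
      have h7 := mul_le_mul_of_nonneg_right h.le_k hε.le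
      have h8 : 3 / ε ^ 2 * ε = 3 * (1 / ε) := by field_simp
      have h9 : ((k : ℝ) - 2 / ε) * ε = k * ε - 2 := by field_simp
      linarith
    · exact mem_filter.2 ⟨mem_univ _, (mem_filter.1 hy).2.1⟩
    · have h5 := (mem_filter.1 hy).2
      rw [IsLarge, div_le_iff₀ hε] at h5
      linarith
  linarith

end IsSquareCriticalWith

end SimpleGraph

namespace SimpleGraph

open scoped Classical

variable {V : Type*}

theorem two_mul_ncard_edgeSet [Fintype V] (G : SimpleGraph V) :
    2 * G.edgeSet.ncard = ∑ v, G.degree v := by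
  rw [sum_degrees_eq_twice_card_edges, ← coe_edgeFinset, Set.ncard_coe_finset]

theorem Subgraph.averageDegree_le_maxAverageDegree [Finite V] {G : SimpleGraph V}
    (H : G.Subgraph) : H.averageDegree ≤ G.maxAverageDegree :=
  le_ciSup (f := fun H : G.Subgraph => H.averageDegree) (Set.finite_range _).bddAbove H

/-- The maximum average degree is less than `c` if each edge can distribute a charge of `2` to its
ends so that every vertex receives less than `c`. -/
theorem maxAverageDegree_lt [Fintype V] (G : SimpleGraph V) {c : ℝ} (hc : 0 < c) (w : V → V → ℝ)
    (hnn : ∀ u v, 0 ≤ w u v) (hw : ∀ u v, G.Adj u v → w u v + w v u = 2)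
    (hsum : ∀ v, ∑ u, (if G.Adj v u then w v u else 0) < c) : G.maxAverageDegree < c := by
  obtain ⟨H, hH⟩ := exists_eq_ciSup_of_finite (f := fun H : G.Subgraph => H.averageDegree)
  rw [maxAverageDegree, ← hH]
  simp only [Subgraph.averageDegree]
  rcases H.verts.eq_empty_or_nonempty with h0 | hne
  · simpa [h0] using hc
  have hpos : (0 : ℝ) < H.verts.ncard := by exact_mod_cast (Set.ncard_pos (Set.toFinite _)).2 hne
  rw [div_lt_iff₀ hpos]
  have h1 : (2 : ℝ) * H.edgeSet.ncard = ∑ v, ∑ u, if H.Adj v u then (1 : ℝ) else 0 := by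
    have h2 := two_mul_ncard_edgeSet H.spanningCoe
    rw [Subgraph.edgeSet_spanningCoe] at h2
    have h3 : (2 : ℝ) * H.edgeSet.ncard = ∑ v, (H.spanningCoe.degree v : ℝ) := by exact_mod_cast h2
    rw [h3]
    refine sum_congr rfl fun v _ => ?_
    rw [← card_neighborFinset_eq_degree, neighborFinset_eq_filter, sum_boole]
    simp only [Subgraph.spanningCoe_adj]
  have h2 : ∑ v, ∑ u, (if H.Adj v u then (1 : ℝ) else 0) =
      ∑ v, ∑ u, if H.Adj v u then w v u else 0 := by
    have h3 : ∑ v, ∑ u, (if H.Adj v u then w u v else 0) =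
        ∑ v, ∑ u, if H.Adj v u then w v u else 0 := by
      rw [sum_comm]
      simp only [H.adj_comm]
    have h4 : ∑ v, ∑ u, (if H.Adj v u then w u v else 0) +
        ∑ v, ∑ u, (if H.Adj v u then w v u else 0) =
        2 * ∑ v, ∑ u, (if H.Adj v u then (1 : ℝ) else 0) := by
      simp only [← sum_add_distrib, mul_sum]
      refine sum_congr rfl fun v _ => sum_congr rfl fun u _ => ?_
      split_ifs with h
      · rw [hw u v (H.adj_sub h).symm]; norm_num
      · norm_num
    linarith
  rw [h1, h2]
  calc ∑ v, ∑ u, (if H.Adj v u then w v u else 0)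
      = ∑ v with v ∈ H.verts, ∑ u, (if H.Adj v u then w v u else 0) := by
        rw [sum_filter]
        refine sum_congr rfl fun v _ => ?_
        split_ifs with h
        · rfl
        · exact sum_eq_zero fun u _ => if_neg fun h' => h (H.edge_vert h')
    _ ≤ ∑ v with v ∈ H.verts, ∑ u, (if G.Adj v u then w v u else 0) := by
        refine sum_le_sum fun v _ => sum_le_sum fun u _ => ?_
        split_ifs with h h' h'
        · exact le_rfl
        · exact absurd (H.adj_sub h) h'
        · exact hnn v u
        · exact le_rfl
    _ < ∑ v with v ∈ H.verts, c := by
        obtain ⟨v, hv⟩ := hne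
        exact sum_lt_sum_of_nonempty ⟨v, by simpa using hv⟩ fun v _ => hsum v
    _ = c * H.verts.ncard := by
        rw [sum_const, nsmul_eq_mul, mul_comm, ← Set.ncard_coe_finset]
        simp

/-- Squares of sparse graphs are colorable from lists with one color more than an upper bound for
the degrees. -/
theorem exists_isPartialListColoring [Fintype V] {G : SimpleGraph V} {ε : ℝ} {k : ℕ} (hε : 0 < ε)
    (hε' : ε ≤ 1 / 20) (hk : 3 / ε ^ 2 ≤ (k : ℝ)) (hmad : G.maxAverageDegree < 3 - ε)
    (hΔ : G.maxDegree ≤ k) (L : V → Finset ℕ) (hL : ∀ v, #(L v) = k + 1) :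
    ∃ C, G.IsPartialListColoring L Set.univ C := by
  by_contra hG
  obtain ⟨G', ⟨hle, hno⟩, hmin⟩ := (wellFounded_lt (α := SimpleGraph V)).has_min
    {G' : SimpleGraph V | G' ≤ G ∧ ¬ ∃ C, G'.IsPartialListColoring L Set.univ C} ⟨G, le_rfl, hG⟩
  have hcrit : G'.IsSquareCriticalWith L ε k :=
    { not_colorable := fun C hC => hno ⟨C, hC⟩
      colorable_of_lt := fun K hK => by
        by_contra hcon
        exact hmin K ⟨hK.le.trans hle, hcon⟩ hK
      pos := hε
      le := hε'
      le_k := hk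
      maxDegree_le := (maxDegree_le_of_forall_degree_le _ _ fun v =>
        (degree_le_of_le hle).trans (G.degree_le_maxDegree v)).trans hΔ
      card_list := hL }
  have hsum := hcrit.zero_le_sum
  let H : G.Subgraph :=
    { verts := {v | 0 < G'.degree v}
      Adj := G'.Adj
      adj_sub := fun h => hle h
      edge_vert := fun {v w} h => (G'.degree_pos_iff_exists_adj v).2 ⟨w, h⟩
      symm := G'.symm }
  have hH := (H.averageDegree_le_maxAverageDegree).trans_lt hmad
  have hspan : H.spanningCoe = G' := rfl
  have hE : (2 : ℝ) * H.edgeSet.ncard = ∑ v, (G'.degree v : ℝ) := by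
    rw [← Subgraph.edgeSet_spanningCoe, hspan]
    exact_mod_cast two_mul_ncard_edgeSet G'
  have hV : H.verts.ncard = #{v | 0 < G'.degree v} := by
    rw [← Set.ncard_coe_finset]
    simp [H]
  have hdeg : ∑ v, (G'.degree v : ℝ) = ∑ v with 0 < G'.degree v, (G'.degree v : ℝ) := by
    rw [sum_filter]
    refine sum_congr rfl fun v _ => ?_
    split_ifs with h
    · rfl
    · have : G'.degree v = 0 := by omega
      rw [this]; norm_num
  rcases Nat.eq_zero_or_pos #{v | 0 < G'.degree v} with h0 | hpos
  · rw [card_eq_zero, filter_eq_empty_iff] at h0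
    have hnoadj : ∀ a b, ¬ G'.Adj a b := fun a b h =>
      h0 (mem_univ a) ((G'.degree_pos_iff_exists_adj a).2 ⟨b, h⟩)
    have hne : ∀ v, (L v).Nonempty := fun v => card_pos.1 (by rw [hL]; omega)
    choose C hC using hne
    refine hno ⟨C, fun v _ => hC v, fun a _ b _ hab => ?_⟩
    rcases hab.2 with h | ⟨z, h, -⟩
    · exact absurd h (hnoadj _ _)
    · exact absurd h (hnoadj _ _)
  · have hpos' : (0 : ℝ) < #{v | 0 < G'.degree v} := by exact_mod_cast hpos
    rw [Subgraph.averageDegree, hE, hV, div_lt_iff₀ hpos', hdeg] at hH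
    rw [sum_add_distrib, sum_sub_distrib, sum_const, sum_const, nsmul_eq_mul, nsmul_eq_mul] at hsum
    linarith

theorem ListColorable.colorable {G : SimpleGraph V} {k : ℕ} (h : G.ListColorable k) :
    G.Colorable k := by
  obtain ⟨C, hC⟩ := h (fun _ => range k) (by simp)
  exact ⟨Coloring.mk (fun v => (⟨C v, mem_range.1 (hC v)⟩ : Fin k)) fun {u v} huv h =>
    C.valid huv (Fin.mk.inj_iff.1 h)⟩

theorem chromaticNumber_le_listChromaticNumber (G : SimpleGraph V) :
    G.chromaticNumber ≤ G.listChromaticNumber :=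
  le_iInf₂ fun _ hk => chromaticNumber_le_iff_colorable.2 (ListColorable.colorable hk)

theorem maxDegree_add_one_le_chromaticNumber_square [Fintype V] [Nonempty V] (G : SimpleGraph V)
    [DecidableRel G.Adj] : (G.maxDegree : ℕ∞) + 1 ≤ G.square.chromaticNumber := by
  obtain ⟨v, hv⟩ := G.exists_maximal_degree_vertex
  have hclique : G.square.IsClique (insert v (G.neighborFinset v) : Finset V) := by
    intro a ha b hb hab
    simp only [coe_insert, coe_neighborFinset, Set.mem_insert_iff, mem_neighborSet] at ha hb
    refine ⟨hab, ?_⟩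
    rcases ha with rfl | ha <;> rcases hb with rfl | hb
    · exact absurd rfl hab
    · exact Or.inl hb
    · exact Or.inl ha.symm
    · exact Or.inr ⟨v, ha.symm, hb⟩
  have h := hclique.card_le_chromaticNumber
  rw [card_insert_of_notMem (by simp), card_neighborFinset_eq_degree, ← hv] at h
  exact_mod_cast h

/-- The relation generating `thetaGraph`. -/
def thetaRel (m : ℕ) : (Fin m × Bool) ⊕ Fin 3 → (Fin m × Bool) ⊕ Fin 3 → Prop
  | .inr a, .inr b => a ≠ 2 ∧ b = 2
  | .inr a, .inl (_, s) => (a = 0 ∧ s = false) ∨ (a = 1 ∧ s = true)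
  | .inl (i, s), .inl (j, s') => i = j ∧ s = false ∧ s' = true
  | .inl _, .inr _ => False

/-- Two vertices joined by `m` paths of length `3` and one path of length `2`. -/
def thetaGraph (m : ℕ) : SimpleGraph ((Fin m × Bool) ⊕ Fin 3) := fromRel (thetaRel m)

/-- A distribution of the charge of each edge of `thetaGraph` to its ends. -/
noncomputable def thetaWeight (m : ℕ) : (Fin m × Bool) ⊕ Fin 3 → (Fin m × Bool) ⊕ Fin 3 → ℝ
  | .inr _, .inr _ => 1
  | .inr _, .inl _ => 1 / (m + 1)
  | .inl _, .inr _ => 2 - 1 / (m + 1)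
  | .inl _, .inl _ => 1

theorem thetaWeight_nonneg (m : ℕ) (a b) : 0 ≤ thetaWeight m a b := by
  have h : (1 : ℝ) / (m + 1) ≤ 1 := div_le_one_of_le₀ (by linarith [Nat.cast_nonneg (α := ℝ) m])
    (by positivity)
  rcases a with a | a <;> rcases b with b | b <;> simp only [thetaWeight]
  · norm_num
  · linarith
  · positivity
  · norm_num

theorem thetaWeight_add (m : ℕ) (a b) : thetaWeight m a b + thetaWeight m b a = 2 := by
  rcases a with a | a <;> rcases b with b | b <;> simp only [thetaWeight] <;> ring

theorem sum_thetaWeight_lt (m : ℕ) (a) :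
    ∑ b, (if (thetaGraph m).Adj a b then thetaWeight m a b else 0) < 3 := by
  have hpos : (0 : ℝ) < 1 / (m + 1) := by positivity
  have hm : (m : ℝ) * (1 / (m + 1)) < 1 := by
    rw [mul_one_div, div_lt_one (by positivity)]; linarith
  rw [Fintype.sum_sum_type, Fintype.sum_prod_type, Fin.sum_univ_three]
  simp only [Fintype.sum_bool]
  rcases a with ⟨i, s⟩ | a
  · rw [one_div] at hpos
    cases s <;> simp [thetaGraph, thetaRel, thetaWeight] <;> linarith
  · fin_cases a <;> simp [thetaGraph, thetaRel, thetaWeight] <;> norm_num at *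
    all_goals linarith

theorem degree_thetaGraph (m : ℕ) (a) : (thetaGraph m).degree a =
    (∑ i, ((if (thetaGraph m).Adj a (.inl (i, true)) then 1 else 0) +
      if (thetaGraph m).Adj a (.inl (i, false)) then 1 else 0)) +
    ((if (thetaGraph m).Adj a (.inr 0) then 1 else 0) +
      (if (thetaGraph m).Adj a (.inr 1) then 1 else 0) +
      if (thetaGraph m).Adj a (.inr 2) then 1 else 0) := by
  rw [← card_neighborFinset_eq_degree, neighborFinset_eq_filter, card_filter,
    Fintype.sum_sum_type, Fintype.sum_prod_type, Fin.sum_univ_three]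
  simp only [Fintype.sum_bool]

theorem degree_thetaGraph_le {m : ℕ} (hm : 1 ≤ m) (a) : (thetaGraph m).degree a ≤ m + 1 := by
  rw [degree_thetaGraph]
  rcases a with ⟨i, s⟩ | a
  · cases s <;> simpa [thetaGraph, thetaRel] using hm
  · fin_cases a <;> simp [thetaGraph, thetaRel, hm]

theorem degree_thetaGraph_zero (m : ℕ) : (thetaGraph m).degree (.inr 0) = m + 1 := by
  rw [degree_thetaGraph]
  simp [thetaGraph, thetaRel]

theorem not_colorable_square_thetaGraph (m : ℕ) : ¬ (thetaGraph m).square.Colorable (m + 2) := by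
  intro h
  let S : Finset ((Fin m × Bool) ⊕ Fin 3) :=
    ((univ : Finset (Fin m)).image fun i => (i, false)).disjSum univ
  have hs : (thetaGraph m).square.IsClique S := by
    have hx : ∀ i, (thetaGraph m).Adj (.inr 0) (.inl (i, false)) := by
      simp [thetaGraph, thetaRel]
    have hw : ∀ i, (thetaGraph m).Adj (.inr 1) (.inl (i, true)) := by
      simp [thetaGraph, thetaRel]
    have hu : ∀ i, (thetaGraph m).Adj (.inl (i, false)) (.inl (i, true)) := by
      simp [thetaGraph, thetaRel]
    have hxt : (thetaGraph m).Adj (.inr 0) (.inr 2) := by simp [thetaGraph, thetaRel]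
    have hwt : (thetaGraph m).Adj (.inr 1) (.inr 2) := by simp [thetaGraph, thetaRel]
    intro a ha b hb hab
    refine ⟨hab, ?_⟩
    rcases a with ⟨i, s⟩ | a <;> rcases b with ⟨j, s'⟩ | b
    · obtain rfl : s = false := by simpa [S, eq_comm] using ha
      obtain rfl : s' = false := by simpa [S, eq_comm] using hb
      exact Or.inr ⟨.inr 0, (hx i).symm, hx j⟩
    · obtain rfl : s = false := by simpa [S, eq_comm] using ha
      fin_cases b
      · exact Or.inl (hx i).symm
      · exact Or.inr ⟨.inl (i, true), hu i, (hw i).symm⟩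
      · exact Or.inr ⟨.inr 0, (hx i).symm, hxt⟩
    · obtain rfl : s' = false := by simpa [S, eq_comm] using hb
      fin_cases a
      · exact Or.inl (hx j)
      · exact Or.inr ⟨.inl (j, true), hw j, (hu j).symm⟩
      · exact Or.inr ⟨.inr 0, hxt.symm, hx j⟩
    · fin_cases a <;> fin_cases b
      · exact absurd rfl hab
      · exact Or.inr ⟨.inr 2, hxt, hwt.symm⟩
      · exact Or.inl hxt
      · exact Or.inr ⟨.inr 2, hwt, hxt.symm⟩
      · exact absurd rfl hab
      · exact Or.inl hwt
      · exact Or.inl hxt.symm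
      · exact Or.inl hwt.symm
      · exact absurd rfl hab
  have hcard := hs.card_le_of_colorable h
  rw [card_disjSum, card_image_of_injective _ fun i j h => (Prod.mk.inj h).1] at hcard
  simp at hcard

/-- Isomorphic graphs have isomorphic squares. -/
def Iso.square {V W : Type*} {G : SimpleGraph V} {H : SimpleGraph W} (f : G ≃g H) :
    G.square ≃g H.square where
  toEquiv := f.toEquiv
  map_rel_iff' {a b} := by
    have hmid : (∃ w, H.Adj (f a) w ∧ H.Adj w (f b)) ↔ ∃ w, G.Adj a w ∧ G.Adj w b := by
      rw [f.surjective.exists (p := fun w => H.Adj (f a) w ∧ H.Adj w (f b))]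
      simp only [f.map_adj_iff]
    change (f a ≠ f b ∧ (H.Adj (f a) (f b) ∨ ∃ w, H.Adj (f a) w ∧ H.Adj w (f b))) ↔ _
    rw [hmid, f.injective.ne_iff, f.map_adj_iff]
    rfl

end SimpleGraph

theorem theorem1 :
    (∃ f : ℝ → ℝ,
      (∀ ε : ℝ, 0 < ε → ε ≤ 1 / 20 → f ε = 3 / ε ^ 2) ∧
      ∀ ε : ℝ, 0 < ε →
        ∀ (V : Type*) [Fintype V] (G : SimpleGraph V) [DecidableRel G.Adj],
          G.maxAverageDegree < 3 - ε → f ε ≤ (G.maxDegree : ℝ) →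
            G.square.listChromaticNumber = (G.maxDegree : ℕ∞) + 1) ∧
    (∀ N : ℕ, ∃ (n : ℕ) (G : SimpleGraph (Fin n)) (_ : DecidableRel G.Adj),
      G.maxAverageDegree < 3 ∧ N ≤ G.maxDegree ∧
        (G.maxDegree : ℕ∞) + 1 < G.square.chromaticNumber ∧
        (G.maxDegree : ℕ∞) + 1 < G.square.listChromaticNumber) := by
  refine ⟨⟨fun ε => 3 / (min ε (1 / 20)) ^ 2, fun ε _ h => by simp only [min_eq_left h], ?_⟩, ?_⟩
  · intro ε hε V _ G _ hmad hΔ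
    have hδ : 0 < min ε (1 / 20) := lt_min hε (by norm_num)
    have hne : Nonempty V := by
      by_contra hemp
      rw [not_nonempty_iff] at hemp
      have h0 : G.maxDegree = 0 := Nat.le_zero.1 (G.maxDegree_le_of_forall_degree_le 0
        fun v => hemp.elim v)
      rw [h0] at hΔ
      have : 0 < 3 / (min ε (1 / 20)) ^ 2 := by positivity
      push_cast at hΔ
      linarith
    refine le_antisymm ?_ ((SimpleGraph.maxDegree_add_one_le_chromaticNumber_square G).trans
      (SimpleGraph.chromaticNumber_le_listChromaticNumber _))
    have hlist : G.square.ListColorable (G.maxDegree + 1) := by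
      intro L hL
      obtain ⟨C, hC, hC'⟩ := SimpleGraph.exists_isPartialListColoring (k := G.maxDegree) hδ
        (min_le_right _ _) hΔ (hmad.trans_le (by linarith [min_le_left ε (1 / 20)]))
        (le_of_eq (by congr!)) L hL
      exact ⟨SimpleGraph.Coloring.mk C fun {u v} huv => hC' u trivial v trivial huv,
        fun v => hC v trivial⟩
    exact (iInf₂_le _ hlist).trans (by push_cast; exact le_rfl)
  · intro N
    classical
    let Γ := SimpleGraph.thetaGraph (N + 1)
    let e := Fintype.equivFin ((Fin (N + 1) × Bool) ⊕ Fin 3)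
    let G : SimpleGraph (Fin (Fintype.card ((Fin (N + 1) × Bool) ⊕ Fin 3))) := Γ.comap e.symm
    let φ : G ≃g Γ := ⟨e.symm, Iff.rfl⟩
    have hdeg : ∀ v, G.degree v = Γ.degree (φ v) := fun v => (φ.degree_eq v).symm
    have hmax : G.maxDegree = N + 2 := by
      refine le_antisymm (G.maxDegree_le_of_forall_degree_le _ fun v => ?_) ?_
      · rw [hdeg]
        convert SimpleGraph.degree_thetaGraph_le (m := N + 1) (by omega) (φ v)
      · refine le_trans (le_of_eq ?_) (G.degree_le_maxDegree (φ.symm (.inr 0)))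
        rw [hdeg, φ.apply_symm_apply]
        convert (SimpleGraph.degree_thetaGraph_zero (N + 1)).symm
    have hχ : (G.maxDegree : ℕ∞) + 1 < G.square.chromaticNumber := by
      rw [hmax, ← not_le]
      intro hle
      have hcol : G.square.Colorable (N + 3) :=
        SimpleGraph.chromaticNumber_le_iff_colorable.1 (by exact_mod_cast hle)
      exact SimpleGraph.not_colorable_square_thetaGraph (N + 1)
        (hcol.of_hom φ.symm.square.toHom)
    refine ⟨_, G, inferInstance, ?_, by omega, hχ,
      hχ.trans_le (SimpleGraph.chromaticNumber_le_listChromaticNumber _)⟩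
    refine SimpleGraph.maxAverageDegree_lt G (by norm_num)
      (fun a b => SimpleGraph.thetaWeight (N + 1) (e.symm a) (e.symm b))
      (fun a b => SimpleGraph.thetaWeight_nonneg _ _ _)
      (fun a b _ => SimpleGraph.thetaWeight_add _ _ _) fun a => ?_
    have h := SimpleGraph.sum_thetaWeight_lt (N + 1) (e.symm a)
    rw [← e.symm.sum_comp] at h
    convert h using 4
    rfl
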